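/- Let $\eta_1=0.1866823\ldots$ and $\eta_2=2.1555352\ldots$ be the two positive real solutions of $\eta(1-\log\eta)=1/2$, and let $0<\delta_1<\eta_1<\eta_2<\delta_2$. For an integer $n\ge 1$ let $r=r(n)$ be the real number with $re^{r}=n$. For a set $\mathcal S$ of positive integers let $B_{n,\mathcal S}$ be the number of partitions of a set with $n$ elements (into nonempty blocks) none of whose block sizes is in $\mathcal S$, and let $\alpha(z)=\alpha_{\mathcal S}(z)=\sum_{k\in\mathcal S} z^k/k!$. Then $$B_{n,\mathcal S}=\frac{n!\,\exp\bigl(e^r-1-\alpha(r)\bigr)}{r^n\sqrt{2\pi r(r+1)e^r}}\left(1+O\!\left(\frac{1+(\alpha'(r))^2}{e^r}\right)\right),$$ uniformly for all $n\ge 1$ and all sets $\mathcal S$ of positive integers with $\mathcal S\cap[\delta_1 r,\delta_2 r]=\emptyset$; that is, the constant implied by the $O$ depends only on $\delta_1$ and $\delta_2$, and not on $n$ or $\mathcal S$. -/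

import Mathlib

/-- The number of partitions of a set with `n` elements (into nonempty blocks) none of whose
block sizes belongs to `S`. -/
noncomputable def avoidingPartitions (n : ℕ) (S : Set ℕ) : ℕ :=
  Nat.card {P : Finpartition (Finset.univ : Finset (Fin n)) // ∀ b ∈ P.parts, b.card ∉ S}

/-- The series `α_S(x) = ∑_{k ∈ S} x ^ k / k!`, which converges absolutely for every real `x`. -/
noncomputable def blockSeries (S : Set ℕ) (x : ℝ) : ℝ :=
  ∑' k : S, x ^ (k : ℕ) / (Nat.factorial (k : ℕ) : ℝ)

/-! Splitting off the block of one element shows that the exponential generating function is `exp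
(e^z - 1 - α(z))`. Cauchy's formula on `|z| = r` (`avoidingPartitions_eq_integral`) then gives an
integral over `θ ∈ [-π, π]`. The radius is the saddle point for `α = 0`: since `n = r e^r`, the term
linear in `θ` coming from `e^z` cancels and the Gaussian `exp (-s²θ²/2)` with `s² = r(r+1)e^r`
remains.

The series `α` is kept as a perturbation and the saddle is not moved. Its linear term `i r α'(r) θ`
survives, but only inside a cosine, so it costs its square. For `θ` of size `1/s` that is at most of
order `α'(r)²/e^r`, the source of the error term. See `circle_estimate_near`.

The perturbation is small because the mass of `∑ r^k/k!` sits near `k = r`, a window that `S`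
avoids. The Chernoff bound `exists_setExp_shiftDown_le` gives `α, α', α'' ≤ K e^{ρr}` at `r`, with
`ρ < 1` and `K` depending only on `δ₁, δ₂`. For large `r` this spoils neither the Gaussian near `θ =
0` nor the decay of `|exp (e^z)|` elsewhere (`circle_estimate_far`). For bounded `r` the claimed
error is bounded below, and the trivial bound on the integral is enough. -/

/-- Partitions of a finite set avoiding blocks whose size lies in `S`. -/
abbrev AvoidingFinpartition {α : Type*} [DecidableEq α] (S : Set ℕ) (s : Finset α) : Type _ :=
  {P : Finpartition s // ∀ b ∈ P.parts, b.card ∉ S}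

/-! ### Set partitions and the recurrence from splitting off one block -/

namespace Finpartition

variable {α : Type*} [DecidableEq α] {s : Finset α}

theorem avoid_part_parts (P : Finpartition s) {b : Finset α} (hb : b ∈ P.parts) :
    (P.avoid b).parts = P.parts.erase b := by
  ext c
  rw [mem_avoid, Finset.mem_erase]
  constructor
  · rintro ⟨d, hd, hdb, rfl⟩
    have hne : d ≠ b := fun h => hdb h.le
    have := P.disjoint hd hb hne
    rw [Function.onFun, id, id] at this
    rw [this.sdiff_eq_left]
    exact ⟨hne, hd⟩
  · rintro ⟨hne, hc⟩
    have := P.disjoint hc hb hne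
    rw [Function.onFun, id, id] at this
    refine ⟨c, hc, fun hle => ?_, this.sdiff_eq_left⟩
    exact P.ne_bot hc (this.eq_bot_of_le hle)

end Finpartition

section Recurrence

variable {α : Type*} [DecidableEq α]

open Classical in
/-- Splitting off the block containing `a`. -/
noncomputable def avoidingFinpartitionInsertEquiv (S : Set ℕ) (s : Finset α) (a : α) (ha : a ∉ s) :
    AvoidingFinpartition S (insert a s) ≃
      Σ t : {t : Finset α // t ∈ s.powerset ∧ t.card + 1 ∉ S},
        AvoidingFinpartition S (s \ t.1) := by
  have key : ∀ t : Finset α, insert a s \ insert a t = s \ t := fun t => by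
    ext x; simp only [Finset.mem_sdiff, Finset.mem_insert, not_or]
    constructor
    · rintro ⟨h1 | h1, h2, h3⟩
      · exact absurd h1 h2
      · exact ⟨h1, h3⟩
    · rintro ⟨h1, h2⟩
      exact ⟨Or.inr h1, fun h => ha (h ▸ h1), h2⟩
  have hpart : ∀ P : Finpartition (insert a s), P.part a ∈ P.parts := fun P =>
    P.part_mem.2 (Finset.mem_insert_self _ _)
  have hins : ∀ P : Finpartition (insert a s), insert a ((P.part a).erase a) = P.part a :=
    fun P => Finset.insert_erase (P.mem_part_self.2 (Finset.mem_insert_self _ _))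
  have hk2 : ∀ P : Finpartition (insert a s), insert a s \ P.part a = s \ (P.part a).erase a :=
    fun P => by rw [← key, hins]
  have hsub : ∀ P : Finpartition (insert a s), (P.part a).erase a ⊆ s := fun P x hx => by
    have := P.part_subset a (Finset.mem_of_mem_erase hx)
    exact (Finset.mem_insert.1 this).resolve_left (Finset.ne_of_mem_erase hx)
  have hcard : ∀ P : Finpartition (insert a s), ((P.part a).erase a).card + 1 = (P.part a).card :=
    fun P => Finset.card_erase_add_one (P.mem_part_self.2 (Finset.mem_insert_self _ _))
  have hext : ∀ t : Finset α, t ⊆ s → (s \ t) ⊔ insert a t = insert a s := fun t ht => by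
    ext x; simp only [Finset.sup_eq_union, Finset.mem_union, Finset.mem_sdiff, Finset.mem_insert]
    have := @ht x
    tauto
  have hdis : ∀ t : Finset α, Disjoint (s \ t) (insert a t) := fun t => by
    rw [Finset.disjoint_left]
    intro x hx h
    rw [Finset.mem_sdiff] at hx
    rcases Finset.mem_insert.1 h with rfl | h
    · exact ha hx.1
    · exact hx.2 h
  refine Equiv.ofBijective (fun P => ⟨⟨(P.1.part a).erase a,
      Finset.mem_powerset.2 (hsub P.1), by rw [hcard]; exact P.2 _ (hpart P.1)⟩,
      ⟨(P.1.avoid (P.1.part a)).copy (hk2 P.1), fun b hb => ?_⟩⟩) ⟨?_, ?_⟩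
  · have hb' : b ∈ (P.1.avoid (P.1.part a)).parts := hb
    rw [Finpartition.avoid_part_parts _ (hpart P.1)] at hb'
    exact P.2 _ (Finset.mem_of_mem_erase hb')
  · rintro ⟨P, hP⟩ ⟨Q, hQ⟩ h
    have h1 : (P.part a).erase a = (Q.part a).erase a :=
      congrArg (fun x => x.1.1) h
    have h2 : (P.avoid (P.part a)).parts = (Q.avoid (Q.part a)).parts :=
      congrArg (fun x => x.2.1.parts) h
    have h3 : P.part a = Q.part a := by rw [← hins P, ← hins Q, h1]
    rw [Finpartition.avoid_part_parts _ (hpart P), Finpartition.avoid_part_parts _ (hpart Q)] at h2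
    refine Subtype.ext (Finpartition.ext ?_)
    rw [← Finset.insert_erase (hpart P), ← Finset.insert_erase (hpart Q), h2, h3]
  · rintro ⟨⟨t, ht, htS⟩, ⟨Q, hQ⟩⟩
    have hts := Finset.mem_powerset.1 ht
    have hat : a ∉ t := fun h => ha (hts h)
    let P : Finpartition (insert a s) :=
      Q.extend (Finset.insert_ne_empty a t) (hdis t) (hext t hts)
    have hPp : P.parts = insert (insert a t) Q.parts := rfl
    have hPa : P.part a = insert a t :=
      P.part_eq_of_mem (by rw [hPp]; exact Finset.mem_insert_self _ _) (Finset.mem_insert_self _ _)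
    have hnot : insert a t ∉ Q.parts := fun h =>
      ha ((Finset.mem_sdiff.1 (Q.subset h (Finset.mem_insert_self a t))).1)
    have hte : (P.part a).erase a = t := by rw [hPa, Finset.erase_insert hat]
    refine ⟨⟨P, fun b hb => ?_⟩, ?_⟩
    · rw [hPp] at hb
      rcases Finset.mem_insert.1 hb with rfl | hb
      · rwa [Finset.card_insert_of_notMem hat]
      · exact hQ b hb
    · refine Sigma.ext (Subtype.ext hte) ?_
      have hparts : (P.avoid (P.part a)).parts = Q.parts := by
        rw [Finpartition.avoid_part_parts _ (hpart P), hPa, hPp, Finset.erase_insert hnot]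
      -- The type of the second component depends on `t`; generalising to `t'` lets the equality be
      -- substituted away.
      have aux : ∀ (t' : Finset α) (h : t' = t) (R : AvoidingFinpartition S (s \ t')),
          R.1.parts = Q.parts → HEq R (⟨Q, hQ⟩ : AvoidingFinpartition S (s \ t)) := by
        rintro t' rfl R hR
        exact heq_of_eq (Subtype.ext (Finpartition.ext hR))
      exact aux _ hte _ hparts

open Classical in
theorem card_avoidingFinpartition_insert (S : Set ℕ) (s : Finset α) (a : α) (ha : a ∉ s) :
    Nat.card (AvoidingFinpartition S (insert a s)) =
      ∑ t ∈ s.powerset, if t.card + 1 ∈ S then 0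
        else Nat.card (AvoidingFinpartition S (s \ t)) := by
  rw [Nat.card_congr (avoidingFinpartitionInsertEquiv S s a ha)]
  have : Finite {t : Finset α // t ∈ s.powerset ∧ t.card + 1 ∉ S} :=
    ((s.powerset.finite_toSet).subset (fun t ht => ht.1)).to_subtype
  have := Fintype.ofFinite {t : Finset α // t ∈ s.powerset ∧ t.card + 1 ∉ S}
  rw [Nat.card_sigma]
  have h2 : ∀ t ∈ s.powerset, (if t.card + 1 ∈ S then 0
        else Nat.card (AvoidingFinpartition S (s \ t))) = (if t.card + 1 ∉ S then
          Nat.card (AvoidingFinpartition S (s \ t)) else 0) := fun t _ => by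
    by_cases h : t.card + 1 ∈ S <;> simp [h]
  rw [Finset.sum_congr rfl h2, ← Finset.sum_filter]
  symm
  exact Finset.sum_subtype _ (fun t => Finset.mem_filter) _

open Classical in
/-- The recurrence obtained by splitting off a block determines the number of partitions. -/
theorem card_avoidingFinpartition_eq (S : Set ℕ) (c : ℕ → ℂ) (h0 : c 0 = 1)
    (hc : ∀ n, c (n + 1) = ∑ k ∈ Finset.range (n + 1),
      (n.choose k : ℂ) * (if k + 1 ∈ S then 0 else 1) * c (n - k)) (s : Finset α) :
    (Nat.card (AvoidingFinpartition S s) : ℂ) = c s.card := by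
  induction s using Finset.strongInduction with
  | H s ih =>
    rcases s.eq_empty_or_nonempty with rfl | ⟨a, ha⟩
    · rw [Finset.card_empty, h0]
      have : Unique (AvoidingFinpartition S (∅ : Finset α)) :=
        { default := ⟨Finpartition.empty _, by simp [Finpartition.empty]⟩
          uniq := fun P => Subtype.ext (Subsingleton.elim (α := Finpartition (⊥ : Finset α)) _ _) }
      simp
    · obtain ⟨s', has', rfl⟩ : ∃ s', a ∉ s' ∧ s = insert a s' :=
        ⟨s.erase a, Finset.notMem_erase _ _, (Finset.insert_erase ha).symm⟩
      rw [card_avoidingFinpartition_insert S s' a has', Finset.card_insert_of_notMem has', hc]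
      push_cast
      rw [Finset.sum_congr rfl (g := fun t => (fun k => if k + 1 ∈ S then 0
        else c (s'.card - k)) t.card)]
      · refine (Finset.sum_powerset_apply_card (fun k => if k + 1 ∈ S then 0
          else c (s'.card - k))).trans ?_
        refine Finset.sum_congr rfl fun k _ => ?_
        rw [nsmul_eq_mul]
        split_ifs <;> simp
      · intro t ht
        have hts := Finset.mem_powerset.1 ht
        dsimp only
        split_ifs
        · rfl
        · rw [ih (s' \ t) (lt_of_le_of_lt Finset.sdiff_subset (Finset.ssubset_insert has')),
            Finset.card_sdiff_of_subset hts]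

end Recurrence

/-! ### Exponential series restricted to a set of exponents -/

section SetExp

variable {𝕜 : Type*} [RCLike 𝕜]

/-- The part of the exponential series with exponents in `T`. -/
noncomputable def setExp (T : Set ℕ) (z : 𝕜) : 𝕜 :=
  ∑' k, T.indicator (fun k => z ^ k / (k.factorial : 𝕜)) k

/-- The set `T` shifted down by one. -/
def shiftDown (T : Set ℕ) : Set ℕ := {k | k + 1 ∈ T}

theorem norm_indicator_pow_div_factorial_le (T : Set ℕ) (z : 𝕜) (k : ℕ) :
    ‖T.indicator (fun k => z ^ k / (k.factorial : 𝕜)) k‖ ≤ ‖z‖ ^ k / (k.factorial : ℝ) := by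
  refine (norm_indicator_le_norm_self _ _).trans (le_of_eq ?_)
  rw [norm_div, norm_pow, RCLike.norm_natCast]

theorem summable_setExp (T : Set ℕ) (z : 𝕜) :
    Summable (T.indicator (fun k => z ^ k / (k.factorial : 𝕜))) :=
  Summable.of_norm_bounded (Real.summable_pow_div_factorial ‖z‖)
    (norm_indicator_pow_div_factorial_le T z)

theorem indicator_succ_mul_pow_div_factorial (T : Set ℕ) (z : 𝕜) (k : ℕ) :
    T.indicator (fun k => (k : 𝕜) * z ^ (k - 1) / (k.factorial : 𝕜)) (k + 1) =
      (shiftDown T).indicator (fun k => z ^ k / (k.factorial : 𝕜)) k := by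
  have h1 : ((k : 𝕜) + 1) ≠ 0 := by exact_mod_cast Nat.succ_ne_zero k
  have h2 : (k.factorial : 𝕜) ≠ 0 := by exact_mod_cast k.factorial_ne_zero
  by_cases h : k + 1 ∈ T
  · rw [Set.indicator_of_mem h, Set.indicator_of_mem (show k ∈ shiftDown T from h),
      Nat.factorial_succ]
    push_cast
    field_simp
  · rw [Set.indicator_of_notMem h, Set.indicator_of_notMem (show k ∉ shiftDown T from h)]

/-- Differentiating `z^k/k!` lowers the exponent by one, so `α'` and `α''` belong to the same family
of series as `α`, and one bound can serve all three. -/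
theorem hasDerivAt_setExp (T : Set ℕ) (z : 𝕜) :
    HasDerivAt (setExp T) (setExp (shiftDown T) z) z := by
  have hsum : ∀ R : ℝ, Summable (fun k : ℕ => (k : ℝ) * R ^ (k - 1) / (k.factorial : ℝ)) := by
    intro R
    rw [← summable_nat_add_iff 1]
    refine (Real.summable_pow_div_factorial R).congr fun k => ?_
    have h1 : ((k : ℝ) + 1) ≠ 0 := by positivity
    rw [Nat.factorial_succ]
    push_cast
    field_simp
  have key := hasDerivAt_tsum_of_isPreconnected (𝕜 := 𝕜)
    (g := fun k y => T.indicator (fun k => y ^ k / (k.factorial : 𝕜)) k)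
    (g' := fun k y => T.indicator (fun k => (k : 𝕜) * y ^ (k - 1) / (k.factorial : 𝕜)) k)
    (y₀ := z) (y := z) (hsum (‖z‖ + 1)) (Metric.isOpen_ball (x := (0 : 𝕜)) (ε := ‖z‖ + 1))
    ((convex_ball (0 : 𝕜) (‖z‖ + 1)).isPreconnected) ?_ ?_ (by simp) (summable_setExp T z) (by simp)
  · convert! key using 1
    -- At `k = 0` the truncated exponent `k - 1` is harmless, since the factor `k` vanishes.
    have h0 : T.indicator (fun k => (k : 𝕜) * z ^ (k - 1) / (k.factorial : 𝕜)) 0 = 0 := by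
      by_cases h : 0 ∈ T <;> simp [h]
    rw [Summable.tsum_eq_zero_add, h0, zero_add]
    · exact tsum_congr fun k => (indicator_succ_mul_pow_div_factorial T z k).symm
    · rw [← summable_nat_add_iff 1]
      exact (summable_setExp (shiftDown T) z).congr
        fun k => (indicator_succ_mul_pow_div_factorial T z k).symm
  · intro k y _
    by_cases h : k ∈ T
    · simp only [Set.indicator_of_mem h]
      exact (hasDerivAt_pow k y).div_const _
    · simp only [Set.indicator_of_notMem h]
      exact hasDerivAt_const _ _
  · intro k y hy
    refine (norm_indicator_le_norm_self _ _).trans ?_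
    rw [norm_div, norm_mul, norm_pow, RCLike.norm_natCast, RCLike.norm_natCast]
    have : ‖y‖ ≤ ‖z‖ + 1 := by simpa using (mem_ball_zero_iff.1 hy).le
    gcongr

theorem deriv_setExp (T : Set ℕ) : deriv (setExp T : 𝕜 → 𝕜) = setExp (shiftDown T) :=
  funext fun z => (hasDerivAt_setExp T z).deriv

theorem setExp_zero (T : Set ℕ) : setExp T (0 : 𝕜) = T.indicator 1 0 := by
  rw [setExp, tsum_eq_single 0]
  · by_cases h : 0 ∈ T <;> simp [h]
  · intro k hk
    by_cases h : k ∈ T <;> simp [h, hk]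

theorem iteratedDeriv_setExp (T : Set ℕ) (n : ℕ) :
    iteratedDeriv n (setExp T : 𝕜 → 𝕜) 0 = T.indicator 1 n := by
  induction n generalizing T with
  | zero => rw [iteratedDeriv_zero, setExp_zero]
  | succ n ih =>
    rw [iteratedDeriv_succ', deriv_setExp, ih]
    rfl

theorem setExp_ofReal (T : Set ℕ) (x : ℝ) : setExp T (x : ℂ) = ((setExp T x : ℝ) : ℂ) := by
  rw [setExp, setExp, Complex.ofReal_tsum]
  refine tsum_congr fun k => ?_
  by_cases h : k ∈ T <;> simp [h]

theorem setExp_nonneg (T : Set ℕ) {x : ℝ} (hx : 0 ≤ x) : 0 ≤ setExp T x :=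
  tsum_nonneg fun k => Set.indicator_nonneg (fun k _ => by positivity) k

/-- Complementary exponents together give `exp z - 1`. -/
theorem setExp_compl_sdiff_zero {S : Set ℕ} (hS : 0 ∉ S) (z : ℂ) :
    setExp {k | k ≠ 0 ∧ k ∉ S} z = Complex.exp z - 1 - setExp S z := by
  have h : setExp {k | k ≠ 0 ∧ k ∉ S} z + setExp S z + setExp {0} z = Complex.exp z := by
    rw [setExp, setExp, setExp, ← (summable_setExp _ z).tsum_add (summable_setExp _ z),
      ← ((summable_setExp _ z).add (summable_setExp _ z)).tsum_add (summable_setExp _ z),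
      Complex.exp_eq_exp_ℂ, NormedSpace.exp_eq_tsum_div]
    refine tsum_congr fun k => ?_
    rcases eq_or_ne k 0 with rfl | h0
    · simp [hS]
    · by_cases h : k ∈ S <;> simp [h, h0]
  have h1 : setExp {0} z = 1 := by
    rw [setExp, tsum_eq_single 0]
    · simp
    · intro k hk
      simp [hk]
  rw [← h, h1]; ring

theorem blockSeries_eq_setExp (S : Set ℕ) : blockSeries S = setExp S := by
  funext x
  rw [blockSeries, setExp]
  exact tsum_subtype S (fun k => x ^ k / (k.factorial : ℝ))

end SetExp

/-! ### Generating function and Cauchy's integral -/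

section Cauchy

theorem differentiable_setExp (T : Set ℕ) : Differentiable ℂ (setExp T : ℂ → ℂ) :=
  fun z => (hasDerivAt_setExp T z).differentiableAt

/-- With `F = exp g` one has `F' = F g'`. Leibniz's rule at `0` turns this into the block
recurrence, because the Taylor derivatives of `g'` are the 0-1 indicators of `k + 1 ∉ S`. -/
theorem avoidingPartitions_eq_iteratedDeriv (S : Set ℕ) (n : ℕ) :
    (avoidingPartitions n S : ℂ) =
      iteratedDeriv n (fun z => Complex.exp (setExp {k | k ≠ 0 ∧ k ∉ S} z)) 0 := by
  classical
  set T : Set ℕ := {k | k ≠ 0 ∧ k ∉ S} with hT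
  set F : ℂ → ℂ := fun z => Complex.exp (setExp T z) with hF
  have hFd : Differentiable ℂ F := (differentiable_setExp T).cexp
  have hderiv : deriv F = F * setExp (shiftDown T) := by
    funext z
    exact ((hasDerivAt_setExp T z).cexp).deriv
  have h := card_avoidingFinpartition_eq S (fun n => iteratedDeriv n F 0) ?_ ?_
    (Finset.univ : Finset (Fin n))
  · rw [Finset.card_univ, Fintype.card_fin] at h
    exact h
  · simp [hF, setExp_zero, hT]
  · intro n
    rw [iteratedDeriv_succ', hderiv, iteratedDeriv_mul hFd.contDiff.contDiffAt
      (differentiable_setExp _).contDiff.contDiffAt, ← Finset.sum_range_reflect]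
    refine Finset.sum_congr rfl fun k hk => ?_
    have hk' : k ≤ n := Nat.lt_succ_iff.1 (Finset.mem_range.1 hk)
    have e1 : n + 1 - 1 - k = n - k := by omega
    have e2 : n - (n - k) = k := by omega
    rw [e1, e2, Nat.choose_symm hk', iteratedDeriv_setExp]
    by_cases h : k + 1 ∈ S
    · simp [shiftDown, hT, h]
    · simp [shiftDown, hT, h]

theorem iteratedDeriv_eq_integral {F : ℂ → ℂ} (hF : Differentiable ℂ F) (n : ℕ) {r : ℝ}
    (hr : 0 < r) :
    iteratedDeriv n F 0 = (n.factorial : ℂ) / (r : ℂ) ^ n * (1 / (2 * Real.pi)) *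
      ∫ θ in (-Real.pi)..Real.pi, F (r * Complex.exp (θ * Complex.I)) *
        Complex.exp (-(n * θ * Complex.I)) := by
  have h := hF.diffContOnCl.circleIntegral_one_div_sub_center_pow_smul (c := 0) hr n
  -- Periodicity moves the range from `[0, 2π]` to `[-π, π]`, centred at the saddle point.
  have hper : Function.Periodic (fun θ : ℝ => F (r * Complex.exp (θ * Complex.I)) *
        Complex.exp (-(n * θ * Complex.I))) (2 * Real.pi) := by
    intro θ
    dsimp only
    congr 1
    · push_cast
      rw [add_mul, Complex.exp_add, Complex.exp_two_pi_mul_I, mul_one]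
    · push_cast
      have : -((n : ℂ) * (θ + 2 * Real.pi) * Complex.I) =
        -(n * θ * Complex.I) + ((-n : ℤ) : ℂ) * (2 * Real.pi * Complex.I) := by push_cast; ring
      rw [this, Complex.exp_add, Complex.exp_int_mul_two_pi_mul_I, mul_one]
  have h2 := hper.intervalIntegral_add_eq 0 (-Real.pi)
  rw [zero_add, show -Real.pi + 2 * Real.pi = Real.pi by ring] at h2
  rw [← h2]
  rw [circleIntegral] at h
  have hr0 : (r : ℂ) ≠ 0 := by exact_mod_cast hr.ne'
  have hpi : (Real.pi : ℂ) ≠ 0 := by exact_mod_cast Real.pi_ne_zero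
  have hI : ∀ θ : ℝ, deriv (circleMap 0 r) θ • (1 / (circleMap 0 r θ - 0) ^ (n + 1)) •
      F (circleMap 0 r θ) = (Complex.I / (r : ℂ) ^ n) *
        (F (r * Complex.exp (θ * Complex.I)) * Complex.exp (-(n * θ * Complex.I))) := by
    intro θ
    rw [deriv_circleMap, circleMap_zero, sub_zero, smul_eq_mul, smul_eq_mul, Complex.exp_neg,
      mul_assoc (n : ℂ), Complex.exp_nat_mul]
    have := Complex.exp_ne_zero (θ * Complex.I)
    field_simp
    ring
  simp_rw [hI] at h
  rw [intervalIntegral.integral_const_mul, smul_eq_mul] at h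
  have hn : (n.factorial : ℂ) ≠ 0 := by exact_mod_cast n.factorial_ne_zero
  have h3 : iteratedDeriv n F 0 = (n.factorial / (2 * Real.pi * Complex.I)) *
      ((2 * Real.pi * Complex.I / n.factorial) * iteratedDeriv n F 0) := by
    have := Complex.I_ne_zero
    field_simp
  rw [h3, ← h]
  generalize (∫ θ in (0 : ℝ)..2 * Real.pi, F (r * Complex.exp (θ * Complex.I)) *
    Complex.exp (-(n * θ * Complex.I))) = J
  have := Complex.I_ne_zero
  field_simp

/-- Cauchy's formula on the circle of radius `r` for the number of avoiding partitions. -/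
theorem avoidingPartitions_eq_integral (S : Set ℕ) (n : ℕ) {r : ℝ} (hr : 0 < r) :
    (avoidingPartitions n S : ℝ) = (n.factorial : ℝ) / r ^ n * (1 / (2 * Real.pi)) *
      ∫ θ in (-Real.pi)..Real.pi,
        Real.exp (setExp {k | k ≠ 0 ∧ k ∉ S} (r * Complex.exp (θ * Complex.I))).re *
        Real.cos ((setExp {k | k ≠ 0 ∧ k ∉ S} (r * Complex.exp (θ * Complex.I))).im - n * θ) := by
  set T : Set ℕ := {k | k ≠ 0 ∧ k ∉ S} with hT
  have hd := differentiable_setExp T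
  have h := iteratedDeriv_eq_integral hd.cexp n hr
  rw [← avoidingPartitions_eq_iteratedDeriv] at h
  have h2 := congrArg Complex.re h
  have e : (n.factorial : ℂ) / (r : ℂ) ^ n * (1 / (2 * Real.pi)) =
    (((n.factorial : ℝ) / r ^ n * (1 / (2 * Real.pi)) : ℝ) : ℂ) := by push_cast; ring
  rw [e, Complex.re_ofReal_mul, Complex.natCast_re] at h2
  rw [h2]
  congr 1
  have hint : IntervalIntegrable (fun θ : ℝ => Complex.exp (setExp T (r * Complex.exp
      (θ * Complex.I))) * Complex.exp (-(n * θ * Complex.I))) MeasureTheory.volume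
      (-Real.pi) Real.pi := by
    apply Continuous.intervalIntegrable
    have := hd.continuous
    fun_prop
  have h4 := Complex.reCLM.intervalIntegral_comp_comm hint
  simp only [Complex.reCLM_apply] at h4
  rw [← h4]
  refine intervalIntegral.integral_congr fun θ _ => ?_
  rw [← Complex.exp_add, Complex.exp_re]
  have e1 : (-((n : ℂ) * θ * Complex.I)) = ((-(n * θ) : ℝ) : ℂ) * Complex.I := by push_cast; ring
  rw [e1]
  simp only [Complex.add_re, Complex.add_im, Complex.re_ofReal_mul, Complex.im_ofReal_mul,
    Complex.I_re, Complex.I_im]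
  ring_nf

end Cauchy

/-! ### Bounds for partial exponential series on the axis and on circles -/

section SetExpBounds

theorem hasSum_setExp {𝕜 : Type*} [RCLike 𝕜] (T : Set ℕ) (z : 𝕜) :
    HasSum (T.indicator (fun k => z ^ k / (k.factorial : 𝕜))) (setExp T z) :=
  (summable_setExp T z).hasSum

theorem indicator_nonneg_pow_div_factorial (T : Set ℕ) {r : ℝ} (hr : 0 ≤ r) (k : ℕ) :
    0 ≤ T.indicator (fun k => r ^ k / (k.factorial : ℝ)) k :=
  Set.indicator_nonneg (fun k _ => by positivity) k

theorem succ_mul_indicator_pow_div_factorial (T : Set ℕ) (r : ℝ) (k : ℕ) :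
    ((k + 1 : ℕ) : ℝ) * T.indicator (fun k => r ^ k / (k.factorial : ℝ)) (k + 1) =
      r * (shiftDown T).indicator (fun k => r ^ k / (k.factorial : ℝ)) k := by
  by_cases h : k + 1 ∈ T
  · rw [Set.indicator_of_mem h, Set.indicator_of_mem (show k ∈ shiftDown T from h),
      Nat.factorial_succ]
    have h1 : ((k : ℝ) + 1) ≠ 0 := by positivity
    push_cast
    field_simp
    ring
  · rw [Set.indicator_of_notMem h, Set.indicator_of_notMem (show k ∉ shiftDown T from h)]
    simp

theorem hasSum_natCast_mul_setExp (T : Set ℕ) (r : ℝ) :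
    HasSum (fun k : ℕ => (k : ℝ) * T.indicator (fun k => r ^ k / (k.factorial : ℝ)) k)
      (r * setExp (shiftDown T) r) := by
  rw [← hasSum_nat_add_iff' 1]
  simp only [Finset.range_one, Finset.sum_singleton, Nat.cast_zero, zero_mul, sub_zero]
  simp_rw [succ_mul_indicator_pow_div_factorial]
  exact (hasSum_setExp _ _).mul_left r

theorem hasSum_natCast_sq_mul_setExp (T : Set ℕ) (r : ℝ) :
    HasSum (fun k : ℕ => (k : ℝ) ^ 2 * T.indicator (fun k => r ^ k / (k.factorial : ℝ)) k)
      (r ^ 2 * setExp (shiftDown (shiftDown T)) r + r * setExp (shiftDown T) r) := by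
  rw [← hasSum_nat_add_iff' 1]
  simp only [Finset.range_one, Finset.sum_singleton, Nat.cast_zero, ne_eq, OfNat.ofNat_ne_zero,
    not_false_eq_true, zero_pow, zero_mul, sub_zero]
  have h := ((hasSum_natCast_mul_setExp (shiftDown T) r).add
    (hasSum_setExp (shiftDown T) r)).mul_left r
  have e : r * (r * setExp (shiftDown (shiftDown T)) r + setExp (shiftDown T) r) =
    r ^ 2 * setExp (shiftDown (shiftDown T)) r + r * setExp (shiftDown T) r := by ring
  rw [e] at h
  refine h.congr_fun fun k => ?_
  rw [pow_two, mul_assoc, succ_mul_indicator_pow_div_factorial]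
  push_cast
  ring

theorem hasSum_setExp_circle (T : Set ℕ) (r θ : ℝ) :
    HasSum (fun k : ℕ => ((T.indicator (fun k => r ^ k / (k.factorial : ℝ)) k : ℝ) : ℂ) *
      Complex.exp ((k * θ : ℝ) * Complex.I)) (setExp T (r * Complex.exp (θ * Complex.I))) := by
  refine (hasSum_setExp T (r * Complex.exp (θ * Complex.I))).congr_fun fun k => ?_
  by_cases h : k ∈ T
  · simp only [Set.indicator_of_mem h]
    push_cast
    rw [mul_pow, ← Complex.exp_nat_mul]
    ring_nf
  · simp [Set.indicator_of_notMem h]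

theorem hasSum_setExp_circle_re (T : Set ℕ) (r θ : ℝ) :
    HasSum (fun k : ℕ => T.indicator (fun k => r ^ k / (k.factorial : ℝ)) k * Real.cos (k * θ))
      (setExp T (r * Complex.exp (θ * Complex.I))).re := by
  refine (Complex.hasSum_re (hasSum_setExp_circle T r θ)).congr_fun fun k => ?_
  rw [Complex.re_ofReal_mul, Complex.exp_ofReal_mul_I_re]

theorem hasSum_setExp_circle_im (T : Set ℕ) (r θ : ℝ) :
    HasSum (fun k : ℕ => T.indicator (fun k => r ^ k / (k.factorial : ℝ)) k * Real.sin (k * θ))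
      (setExp T (r * Complex.exp (θ * Complex.I))).im := by
  refine (Complex.hasSum_im (hasSum_setExp_circle T r θ)).congr_fun fun k => ?_
  rw [Complex.im_ofReal_mul, Complex.exp_ofReal_mul_I_im]

theorem setExp_circle_re_le (T : Set ℕ) {r : ℝ} (hr : 0 ≤ r) (θ : ℝ) :
    (setExp T (r * Complex.exp (θ * Complex.I))).re ≤ setExp T r :=
  hasSum_le (fun k => mul_le_of_le_one_right (indicator_nonneg_pow_div_factorial T hr k)
    (Real.cos_le_one _)) (hasSum_setExp_circle_re T r θ) (hasSum_setExp T r)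

theorem neg_setExp_le_circle_re (T : Set ℕ) {r : ℝ} (hr : 0 ≤ r) (θ : ℝ) :
    -setExp T r ≤ (setExp T (r * Complex.exp (θ * Complex.I))).re :=
  hasSum_le (fun k => by
    nlinarith [indicator_nonneg_pow_div_factorial T hr k, Real.neg_one_le_cos (k * θ)])
    (hasSum_setExp T r).neg (hasSum_setExp_circle_re T r θ)

/-- Termwise `1 - cos (kθ) ≤ k²θ²/2`, and `k² = k(k-1) + k` expresses the second moment through the
first two derivatives. -/
theorem setExp_sub_circle_re_le (T : Set ℕ) {r : ℝ} (hr : 0 ≤ r) (θ : ℝ) :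
    setExp T r - (setExp T (r * Complex.exp (θ * Complex.I))).re ≤
      (r ^ 2 * setExp (shiftDown (shiftDown T)) r + r * setExp (shiftDown T) r) * (θ ^ 2 / 2) := by
  refine hasSum_le (fun k => ?_) ((hasSum_setExp T r).sub (hasSum_setExp_circle_re T r θ))
    ((hasSum_natCast_sq_mul_setExp T r).mul_right _)
  have h1 := indicator_nonneg_pow_div_factorial T hr k
  have h2 := Real.one_sub_sq_div_two_le_cos (x := k * θ)
  nlinarith [mul_le_mul_of_nonneg_left h2 h1]

theorem abs_setExp_circle_im_le (T : Set ℕ) {r : ℝ} (hr : 0 ≤ r) (θ : ℝ) :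
    |(setExp T (r * Complex.exp (θ * Complex.I))).im| ≤ r * setExp (shiftDown T) r * |θ| := by
  rw [← Real.norm_eq_abs, ← (hasSum_setExp_circle_im T r θ).tsum_eq]
  refine tsum_of_norm_bounded ((hasSum_natCast_mul_setExp T r).mul_right |θ|) fun k => ?_
  rw [norm_mul, Real.norm_eq_abs, Real.norm_eq_abs,
    abs_of_nonneg (indicator_nonneg_pow_div_factorial T hr k)]
  have h1 := indicator_nonneg_pow_div_factorial T hr k
  have h2 : |Real.sin (k * θ)| ≤ k * |θ| := by
    refine Real.abs_sin_le_abs.trans (le_of_eq ?_)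
    rw [abs_mul, Nat.abs_cast]
  calc _ ≤ T.indicator (fun k => r ^ k / (k.factorial : ℝ)) k * (k * |θ|) := by gcongr
    _ = _ := by ring

theorem setExp_le_exponential (T : Set ℕ) {r A x B y : ℝ} (hr : 0 ≤ r) (hA : 0 ≤ A) (hx : 0 ≤ x)
    (hB : 0 ≤ B) (hy : 0 ≤ y) (h : ∀ k ∈ T, 1 ≤ A * x ^ k + B * y ^ k) :
    setExp T r ≤ A * Real.exp (x * r) + B * Real.exp (y * r) := by
  have hs : ∀ z : ℝ, HasSum (fun k : ℕ => z ^ k / (k.factorial : ℝ)) (Real.exp z) := fun z => by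
    rw [Real.exp_eq_exp_ℝ]; exact NormedSpace.expSeries_div_hasSum_exp z
  refine hasSum_le (fun k => ?_) (hasSum_setExp T r)
    (((hs (x * r)).mul_left A).add ((hs (y * r)).mul_left B))
  have e : A * ((x * r) ^ k / (k.factorial : ℝ)) + B * ((y * r) ^ k / (k.factorial : ℝ)) =
    (A * x ^ k + B * y ^ k) * (r ^ k / (k.factorial : ℝ)) := by
    rw [mul_pow, mul_pow]; ring
  rw [e]
  have hp : 0 ≤ r ^ k / (k.factorial : ℝ) := by positivity
  by_cases hk : k ∈ T
  · rw [Set.indicator_of_mem hk]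
    nlinarith [h k hk]
  · rw [Set.indicator_of_notMem hk]
    positivity

/-- This is `log x < x - 1` at `x = 1/δ`; it makes the Chernoff exponent strictly less than `1`. -/
theorem mul_one_sub_log_lt_one {δ : ℝ} (h0 : 0 < δ) (h1 : δ ≠ 1) :
    δ * (1 - Real.log δ) < 1 := by
  have h := Real.log_lt_sub_one_of_pos (inv_pos.2 h0) (by simpa using h1)
  rw [Real.log_inv] at h
  have := mul_lt_mul_of_pos_left h h0
  rw [mul_sub, mul_inv_cancel₀ h0.ne'] at this
  linarith

/-- A Chernoff bound: removing the exponents near `r` saves an exponential factor. -/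
theorem exists_setExp_shiftDown_le {δ₁ δ₂ : ℝ} (h₁ : 0 < δ₁) (h₁' : δ₁ < 1) (h₂ : 1 < δ₂) :
    ∃ K ρ : ℝ, 0 < K ∧ ρ < 1 ∧ ∀ r : ℝ, 0 < r → ∀ S : Set ℕ,
      (∀ k ∈ S, (k : ℝ) ∉ Set.Icc (δ₁ * r) (δ₂ * r)) →
      ∀ T : Set ℕ, ∀ j ≤ 2, (∀ k ∈ T, k + j ∈ S) → setExp T r ≤ K * Real.exp (ρ * r) := by
  -- The weight `δ^(k+j-δr)` is at least `1` for `k+j < δ₁r` with `δ = δ₁ < 1`, and for `k+j > δ₂r`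
  -- with `δ = δ₂ > 1`. Summed against `r^k/k!` it gives `δ^j exp (δ(1 - log δ) r)`.
  set ρ := max (δ₁ * (1 - Real.log δ₁)) (δ₂ * (1 - Real.log δ₂)) with hρ
  refine ⟨1 + δ₂ ^ 2, ρ, by positivity, max_lt (mul_one_sub_log_lt_one h₁ h₁'.ne)
    (mul_one_sub_log_lt_one (by linarith) h₂.ne'), fun r hr S hS T j hj hT => ?_⟩
  have h₂0 : 0 < δ₂ := by linarith
  have hpow : ∀ δ : ℝ, 0 < δ → ∀ k : ℕ, δ ^ ((j : ℝ) - δ * r) * δ ^ k =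
      δ ^ (((k + j : ℕ) : ℝ) - δ * r) := fun δ hδ k => by
    rw [← Real.rpow_natCast δ k, ← Real.rpow_add hδ]
    push_cast
    ring_nf
  have hexp : ∀ δ : ℝ, 0 < δ → δ ^ ((j : ℝ) - δ * r) * Real.exp (δ * r) =
      δ ^ j * Real.exp (δ * (1 - Real.log δ) * r) := fun δ hδ => by
    rw [Real.rpow_sub hδ, Real.rpow_natCast, Real.rpow_def_of_pos hδ, div_mul_eq_mul_div,
      mul_div_assoc, ← Real.exp_sub]
    ring_nf
  have h := setExp_le_exponential T (A := δ₁ ^ ((j : ℝ) - δ₁ * r)) (x := δ₁)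
    (B := δ₂ ^ ((j : ℝ) - δ₂ * r)) (y := δ₂) hr.le (by positivity) h₁.le (by positivity) h₂0.le ?_
  · rw [hexp _ h₁, hexp _ h₂0] at h
    refine h.trans ?_
    rw [add_mul]
    have e1 : δ₁ ^ j ≤ 1 := pow_le_one₀ h₁.le h₁'.le
    have e2 : δ₂ ^ j ≤ δ₂ ^ 2 := pow_le_pow_right₀ h₂.le hj
    have e3 : δ₁ * (1 - Real.log δ₁) * r ≤ ρ * r :=
      mul_le_mul_of_nonneg_right (le_max_left _ _) hr.le
    have e4 : δ₂ * (1 - Real.log δ₂) * r ≤ ρ * r :=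
      mul_le_mul_of_nonneg_right (le_max_right _ _) hr.le
    gcongr
  · intro k hk
    rw [hpow _ h₁, hpow _ h₂0]
    have hk' := hS _ (hT k hk)
    rw [Set.mem_Icc, not_and_or, not_le, not_le] at hk'
    rcases hk' with hk' | hk'
    · have := Real.one_le_rpow_of_pos_of_le_one_of_nonpos h₁ h₁'.le
        (z := ((k + j : ℕ) : ℝ) - δ₁ * r) (by linarith)
      have := Real.rpow_nonneg h₂0.le (((k + j : ℕ) : ℝ) - δ₂ * r)
      linarith
    · have := Real.one_le_rpow h₂.le (z := ((k + j : ℕ) : ℝ) - δ₂ * r) (by linarith)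
      have := Real.rpow_nonneg h₁.le (((k + j : ℕ) : ℝ) - δ₁ * r)
      linarith

/-- Differentiating a partial exponential series costs at most a constant factor. -/
theorem setExp_shiftDown_le (T : Set ℕ) {r : ℝ} (hr : 0 < r) :
    setExp (shiftDown T) r ≤ Real.exp 1 * setExp T r + Real.exp 1 := by
  have hs : HasSum (fun k : ℕ => (Real.exp 1 * r) ^ k / (k.factorial : ℝ))
      (Real.exp (Real.exp 1 * r)) := by
    rw [Real.exp_eq_exp_ℝ]; exact NormedSpace.expSeries_div_hasSum_exp _
  have hs1 := (hs.mul_left (Real.exp (1 - Real.exp 1 * r)))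
  rw [← Real.exp_add, sub_add_cancel] at hs1
  have hT := (hasSum_nat_add_iff' 1).2 (hasSum_setExp T r)
  have h0 : T.indicator (fun k => r ^ k / (k.factorial : ℝ)) 0 ≥ 0 :=
    indicator_nonneg_pow_div_factorial T hr.le 0
  have hle : setExp (shiftDown T) r ≤ Real.exp 1 * (setExp T r - ∑ i ∈ Finset.range 1,
      T.indicator (fun k => r ^ k / (k.factorial : ℝ)) i) + Real.exp 1 := by
    refine hasSum_le (fun k => ?_) (hasSum_setExp (shiftDown T) r) ((hT.mul_left _).add hs1)
    have hp : 0 < r ^ k / (k.factorial : ℝ) := by positivity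
    have hi := indicator_nonneg_pow_div_factorial T hr.le (k + 1)
    have hi' := indicator_nonneg_pow_div_factorial (shiftDown T) hr.le k
    have key := succ_mul_indicator_pow_div_factorial T r k
    -- If `k + 1 ≤ e r`, lowering the exponent multiplies the term by at most `e`. Beyond that, the
    -- Chernoff weight `e^(k+1-er)` exceeds `1`, and the weighted exponential series sums to `e`.
    rcases le_or_gt ((k + 1 : ℕ) : ℝ) (Real.exp 1 * r) with hk | hk
    · have h2 : (0:ℝ) ≤ Real.exp (1 - Real.exp 1 * r) *
        ((Real.exp 1 * r) ^ k / (k.factorial : ℝ)) := by positivity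
      have h3 := mul_le_mul_of_nonneg_right hk hi
      rw [key, mul_comm (Real.exp 1) r, mul_assoc] at h3
      have := le_of_mul_le_mul_left h3 hr
      linarith
    · have h2 : r ^ k / (k.factorial : ℝ) ≤ Real.exp (1 - Real.exp 1 * r) *
          ((Real.exp 1 * r) ^ k / (k.factorial : ℝ)) := by
        have e : Real.exp (1 - Real.exp 1 * r) * ((Real.exp 1 * r) ^ k / (k.factorial : ℝ)) =
            Real.exp (((k + 1 : ℕ) : ℝ) - Real.exp 1 * r) * (r ^ k / (k.factorial : ℝ)) := by
          rw [mul_pow, ← Real.exp_nat_mul, mul_one, mul_div_assoc, ← mul_assoc, ← Real.exp_add]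
          push_cast
          ring_nf
        rw [e]
        exact le_mul_of_one_le_left hp.le (Real.one_le_exp (by linarith))
      have h3 : (shiftDown T).indicator (fun k => r ^ k / (k.factorial : ℝ)) k ≤
        r ^ k / (k.factorial : ℝ) := Set.indicator_le_self' (fun _ _ => hp.le) k
      have : 0 ≤ Real.exp 1 * T.indicator (fun k => r ^ k / (k.factorial : ℝ)) (k + 1) := by
        positivity
      linarith
  refine hle.trans ?_
  rw [Finset.sum_range_one]
  have := Real.exp_pos 1
  nlinarith

end SetExpBounds

/-! ### Taylor estimates on the circle -/

section CircleEstimates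

/-- The two products are the real and imaginary parts of `exp (r e^{iθ} - r)`. Since `r ≥ 1`, the
remainders with lower powers of `r` are absorbed into `r⁴θ⁴` and `r³|θ|³`. -/
theorem abs_exp_mul_cos_sub_le {r θ : ℝ} (hr : 1 ≤ r) (hθ : r * |θ| ≤ 1) :
    |Real.exp (-(r * (1 - Real.cos θ))) * Real.cos (r * Real.sin θ) - 1 +
      (r + r ^ 2) * θ ^ 2 / 2| ≤ r ^ 4 * θ ^ 4 ∧
    |Real.exp (-(r * (1 - Real.cos θ))) * Real.sin (r * Real.sin θ) - r * θ| ≤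
      r ^ 3 * |θ| ^ 3 := by
  have hr0 : 0 < r := by linarith
  set x := |θ| with hx
  have hx0 : 0 ≤ x := abs_nonneg _
  have hxr : x ≤ r * x := le_mul_of_one_le_left hx0 hr
  have hx1 : x ≤ 1 := hxr.trans hθ
  have hθ2 : θ ^ 2 = x ^ 2 := (sq_abs θ).symm
  have hθ4 : θ ^ 4 = x ^ 4 := by rw [show (4 : ℕ) = 2 * 2 by rfl, pow_mul, pow_mul, hθ2]
  have hrx : r * x ^ 2 ≤ 1 := by nlinarith
  set a := r * (1 - Real.cos θ) with ha
  set b := r * Real.sin θ with hb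
  set E := Real.exp (-a) with hE
  have ha0 : 0 ≤ a := mul_nonneg hr0.le (by linarith [Real.cos_le_one θ])
  have ha1 : a ≤ r * x ^ 2 / 2 := by
    have := Real.one_sub_sq_div_two_le_cos (x := θ)
    rw [hθ2] at this
    rw [ha]; nlinarith
  have ha2 : |a - r * x ^ 2 / 2| ≤ r * (x ^ 4 * (5 / 96)) := by
    have := Real.cos_bound (x := θ) hx1
    rw [← hx, hθ2] at this
    rw [ha, show r * (1 - Real.cos θ) - r * x ^ 2 / 2 = -(r * (Real.cos θ - (1 - x ^ 2 / 2))) by ring,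
      abs_neg, abs_mul, abs_of_pos hr0]
    gcongr
  have hE1 : |E - 1 + a| ≤ a ^ 2 := by
    have := Real.abs_exp_sub_one_sub_id_le (x := -a) (by rw [abs_neg, abs_of_nonneg ha0]; linarith)
    rwa [sub_neg_eq_add, neg_sq] at this
  have hE2 : |E - 1| ≤ a := by
    rw [abs_le]
    constructor
    · linarith [Real.add_one_le_exp (-a)]
    · linarith [Real.exp_le_one_iff.2 (neg_nonpos.2 ha0)]
  have hs1 : |b| ≤ r * x := by
    rw [hb, abs_mul, abs_of_pos hr0]
    exact mul_le_mul_of_nonneg_left Real.abs_sin_le_abs hr0.le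
  have hs2 : |b - r * θ| ≤ r * (x ^ 3 / 4) := by
    have h := Real.sin_bound (x := θ) hx1
    rw [← hx] at h
    have h3 : |θ ^ 3 / 6| = x ^ 3 / 6 := by rw [abs_div, abs_pow, ← hx]; norm_num
    have h4 : x ^ 5 ≤ x ^ 3 := pow_le_pow_of_le_one hx0 hx1 (by norm_num)
    have h5 : |Real.sin θ - θ| ≤ x ^ 3 / 4 := by
      calc |Real.sin θ - θ| = |(Real.sin θ - (θ - θ ^ 3 / 6)) - θ ^ 3 / 6| := by ring_nf
        _ ≤ x ^ 5 / 100 + x ^ 3 / 6 := (abs_sub _ _).trans (by rw [h3]; linarith)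
        _ ≤ x ^ 3 / 4 := by nlinarith [pow_nonneg hx0 3]
    rw [hb, ← mul_sub, abs_mul, abs_of_pos hr0]
    gcongr
  have hb1 : |b| ≤ 1 := hs1.trans hθ
  have hb2 : |b ^ 2 - r ^ 2 * x ^ 2| ≤ r ^ 2 * x ^ 4 / 2 := by
    rw [← hθ2, show b ^ 2 - r ^ 2 * θ ^ 2 = (b - r * θ) * (b + r * θ) by ring, abs_mul]
    have h1 : |b + r * θ| ≤ r * x + r * x := (abs_add_le _ _).trans
      (add_le_add hs1 (by rw [abs_mul, abs_of_pos hr0]))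
    calc |b - r * θ| * |b + r * θ| ≤ (r * (x ^ 3 / 4)) * (r * x + r * x) := by gcongr
      _ = _ := by ring
  have hb2' : b ^ 2 ≤ r ^ 2 * x ^ 2 := by
    rw [← mul_pow, ← sq_abs b]; gcongr
  have hc1 : |Real.cos b - (1 - b ^ 2 / 2)| ≤ r ^ 4 * x ^ 4 * (5 / 96) := by
    refine (Real.cos_bound hb1).trans ?_
    rw [← mul_pow]; gcongr
  have hc2 : |Real.cos b - 1| ≤ r ^ 2 * x ^ 2 / 2 := by
    have := Real.one_sub_sq_div_two_le_cos (x := b)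
    rw [abs_le]
    constructor
    · linarith
    · have := Real.cos_le_one b
      have : 0 ≤ r ^ 2 * x ^ 2 / 2 := by positivity
      linarith
  have hx4 : 0 ≤ x ^ 4 := by positivity
  have hp1 : r * x ^ 4 ≤ r ^ 4 * x ^ 4 :=
    mul_le_mul_of_nonneg_right (by simpa using pow_le_pow_right₀ hr (show 1 ≤ 4 by norm_num)) hx4
  have hp2 : r ^ 2 * x ^ 4 ≤ r ^ 4 * x ^ 4 :=
    mul_le_mul_of_nonneg_right (pow_le_pow_right₀ hr (by norm_num)) hx4
  have hp3 : r ^ 3 * x ^ 4 ≤ r ^ 4 * x ^ 4 :=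
    mul_le_mul_of_nonneg_right (pow_le_pow_right₀ hr (by norm_num)) hx4
  have ha3 : a ^ 2 ≤ r ^ 2 * x ^ 4 / 4 := by
    calc a ^ 2 ≤ (r * x ^ 2 / 2) ^ 2 := by gcongr
      _ = _ := by ring
  constructor
  · have hprod : |(E - 1) * (Real.cos b - 1)| ≤ r ^ 3 * x ^ 4 / 4 := by
      rw [abs_mul]
      calc _ ≤ (r * x ^ 2 / 2) * (r ^ 2 * x ^ 2 / 2) := by gcongr; exact hE2.trans ha1
        _ = _ := by ring
    rw [hθ2, hθ4]
    have e : E * Real.cos b - 1 + (r + r ^ 2) * x ^ 2 / 2 =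
      (E - 1 + a) - (a - r * x ^ 2 / 2) + (Real.cos b - (1 - b ^ 2 / 2)) -
        (b ^ 2 - r ^ 2 * x ^ 2) / 2 + (E - 1) * (Real.cos b - 1) := by ring
    rw [e]
    rw [abs_le] at *
    constructor <;> linarith [hE1.1, hE1.2, ha2.1, ha2.2, hc1.1, hc1.2, hb2.1, hb2.2, hprod.1,
      hprod.2]
  · have hsb : |Real.sin b| ≤ r * x := Real.abs_sin_le_abs.trans hs1
    have hx3 : 0 ≤ x ^ 3 := by positivity
    have hq1 : r * x ^ 3 ≤ r ^ 3 * x ^ 3 :=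
      mul_le_mul_of_nonneg_right (by simpa using pow_le_pow_right₀ hr (show 1 ≤ 3 by norm_num)) hx3
    have hq2 : r ^ 2 * x ^ 3 ≤ r ^ 3 * x ^ 3 :=
      mul_le_mul_of_nonneg_right (pow_le_pow_right₀ hr (by norm_num)) hx3
    have hprod : |(E - 1) * Real.sin b| ≤ r ^ 2 * x ^ 3 / 2 := by
      rw [abs_mul]
      calc _ ≤ (r * x ^ 2 / 2) * (r * x) := by gcongr; exact hE2.trans ha1
        _ = _ := by ring
    have hsb2 : |Real.sin b - b| ≤ r ^ 3 * x ^ 3 / 4 := by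
      have h := Real.sin_bound hb1
      have h3 : |b ^ 3 / 6| = |b| ^ 3 / 6 := by rw [abs_div, abs_pow]; norm_num
      have h4 : |b| ^ 5 ≤ |b| ^ 3 := pow_le_pow_of_le_one (abs_nonneg _) hb1 (by norm_num)
      have h6 : |b| ^ 3 ≤ r ^ 3 * x ^ 3 := by rw [← mul_pow]; gcongr
      calc |Real.sin b - b| = |(Real.sin b - (b - b ^ 3 / 6)) - b ^ 3 / 6| := by ring_nf
        _ ≤ |b| ^ 5 / 100 + |b| ^ 3 / 6 := (abs_sub _ _).trans (by rw [h3]; linarith)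
        _ ≤ r ^ 3 * x ^ 3 / 4 := by nlinarith [pow_nonneg (abs_nonneg b) 3]
    have e : E * Real.sin b - r * θ = (E - 1) * Real.sin b + (Real.sin b - b) + (b - r * θ) := by
      ring
    rw [e]
    rw [abs_le] at *
    constructor <;> linarith [hprod.1, hprod.2, hsb2.1, hsb2.2, hs2.1, hs2.2]

/-- Half of the decay `exp (-v/2)` pays for the factor `exp |X + v/2|`; the phase enters
quadratically because cosine is even. -/
theorem abs_exp_mul_cos_sub_exp_le {X Y v : ℝ} (h : |X + v / 2| ≤ v / 4) :
    |Real.exp X * Real.cos Y - Real.exp (-(v / 2))| ≤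
      Real.exp (-(v / 4)) * (|X + v / 2| + Y ^ 2 / 2) := by
  set x := X + v / 2 with hx
  have hX : X = -(v / 2) + x := by rw [hx]; ring
  have h1 : |Real.exp x * Real.cos Y - 1| ≤ Real.exp |x| * (|x| + Y ^ 2 / 2) := by
    have h2 : |Real.exp x - 1| ≤ Real.exp |x| * |x| := by
      have h5 := Real.one_le_exp (abs_nonneg x)
      have h6 := abs_nonneg x
      rw [abs_le]
      constructor
      · have := Real.add_one_le_exp x
        have := neg_abs_le x
        nlinarith
      · have h3 := Real.add_one_le_exp (-x)
        have h4 : Real.exp x * Real.exp (-x) = 1 := by rw [← Real.exp_add]; simp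
        have h7 : Real.exp x - 1 ≤ Real.exp x * x := by nlinarith [Real.exp_pos x]
        refine h7.trans ?_
        calc Real.exp x * x ≤ Real.exp x * |x| := by gcongr; exact le_abs_self x
          _ ≤ _ := by gcongr; exact le_abs_self x
    have h3 : |Real.cos Y - 1| ≤ Y ^ 2 / 2 := by
      rw [abs_le]
      constructor
      · linarith [Real.one_sub_sq_div_two_le_cos (x := Y)]
      · linarith [Real.cos_le_one Y, sq_nonneg Y]
    calc |Real.exp x * Real.cos Y - 1| = |(Real.exp x - 1) + Real.exp x * (Real.cos Y - 1)| := by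
          ring_nf
      _ ≤ |Real.exp x - 1| + |Real.exp x * (Real.cos Y - 1)| := abs_add_le _ _
      _ ≤ Real.exp |x| * |x| + Real.exp |x| * (Y ^ 2 / 2) := by
          rw [abs_mul, Real.abs_exp]
          gcongr
          exact le_abs_self x
      _ = _ := by ring
  have h2 : Real.exp X * Real.cos Y - Real.exp (-(v / 2)) =
      Real.exp (-(v / 2)) * (Real.exp x * Real.cos Y - 1) := by
    rw [hX, Real.exp_add]; ring
  rw [h2, abs_mul, Real.abs_exp]
  calc _ ≤ Real.exp (-(v / 2)) * (Real.exp |x| * (|x| + Y ^ 2 / 2)) := by gcongr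
    _ = Real.exp (-(v / 2) + |x|) * (|x| + Y ^ 2 / 2) := by rw [Real.exp_add]; ring
    _ ≤ _ := by gcongr; linarith

/-- Half of the remaining decay absorbs the polynomial. With `t = v/8` and `t^j ≤ j! e^t` the
constant is `512·6 + 64·2 + 32 = 3232`. -/
theorem cubic_mul_exp_neg_le {v : ℝ} (hv : 0 ≤ v) :
    (v ^ 3 + v ^ 2 + 4 * v) * Real.exp (-(v / 4)) ≤ 4000 * Real.exp (-(v / 8)) := by
  have h := Real.pow_div_factorial_le_exp (x := v / 8) (by positivity)
  have h1 := h 1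
  have h2 := h 2
  have h3 := h 3
  simp only [Nat.factorial] at h1 h2 h3
  push_cast at h1 h2 h3
  have : v ^ 3 + v ^ 2 + 4 * v ≤ 4000 * Real.exp (v / 8) := by
    have := Real.exp_pos (v / 8)
    ring_nf at *
    linarith
  calc _ ≤ 4000 * Real.exp (v / 8) * Real.exp (-(v / 4)) := by gcongr
    _ = _ := by rw [mul_assoc, ← Real.exp_add]; ring_nf

end CircleEstimates

/-! ### Comparison with a Gaussian integral -/

section GaussianComparison

open MeasureTheory

theorem integral_exp_neg_sq_mul_div {s c : ℝ} (hs : 0 < s) (hc : 0 < c) :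
    ∫ θ : ℝ, Real.exp (-(s ^ 2 * θ ^ 2 / c)) = √(c * Real.pi) / s := by
  have h := integral_gaussian (s ^ 2 / c)
  rw [show Real.pi / (s ^ 2 / c) = c * Real.pi / s ^ 2 by field_simp,
    Real.sqrt_div (by positivity), Real.sqrt_sq hs.le] at h
  rw [← h]
  congr 1
  funext θ
  ring_nf

theorem integrable_exp_neg_sq_mul_div {s c : ℝ} (hs : 0 < s) (hc : 0 < c) :
    Integrable (fun θ : ℝ => Real.exp (-(s ^ 2 * θ ^ 2 / c))) := by
  refine (integrable_exp_neg_mul_sq (b := s ^ 2 / c) (by positivity)).congr ?_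
  refine Filter.Eventually.of_forall fun θ => ?_
  ring_nf

/-- `M` measures an error with Gaussian decay, which also covers the tail outside `[-π, π]`; `δ`
allows a uniform error on the circle away from the saddle point. -/
theorem abs_intervalIntegral_sub_gaussian_le {f : ℝ → ℝ} (hf : Continuous f) {s M δ : ℝ}
    (hs : 0 < s)
    (h : ∀ θ, |θ| ≤ Real.pi →
      |f θ - Real.exp (-(s ^ 2 * θ ^ 2 / 2))| ≤ M * Real.exp (-(s ^ 2 * θ ^ 2 / 8)) + δ)
    (h' : ∀ θ, Real.pi ≤ |θ| →
      Real.exp (-(s ^ 2 * θ ^ 2 / 2)) ≤ M * Real.exp (-(s ^ 2 * θ ^ 2 / 8))) :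
    |(∫ θ in (-Real.pi)..Real.pi, f θ) - √(2 * Real.pi) / s| ≤
      M * (√(8 * Real.pi) / s) + 2 * Real.pi * δ := by
  have hpi := Real.pi_pos
  set I := Set.Ioc (-Real.pi) Real.pi with hI
  have hIm : MeasurableSet I := measurableSet_Ioc
  have g2 := integrable_exp_neg_sq_mul_div hs (c := 2) (by norm_num)
  have g8 := (integrable_exp_neg_sq_mul_div hs (c := 8) (by norm_num)).const_mul M
  have hfI : IntegrableOn f I := (hf.integrableOn_Icc).mono_set Set.Ioc_subset_Icc_self
  have hδI : IntegrableOn (fun _ : ℝ => δ) I := (continuous_const.integrableOn_Icc).mono_set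
    Set.Ioc_subset_Icc_self
  rw [intervalIntegral.integral_of_le (by linarith), ← integral_exp_neg_sq_mul_div hs two_pos,
    ← integral_exp_neg_sq_mul_div hs (show (0:ℝ) < 8 by norm_num), ← integral_const_mul,
    ← integral_add_compl hIm g2, ← integral_add_compl hIm g8]
  have hδ : ∫ _ in I, δ = 2 * Real.pi * δ := by
    rw [setIntegral_const, hI, Real.volume_real_Ioc_of_le (by linarith), smul_eq_mul]
    ring
  have h1 : |(∫ θ in I, f θ) - ∫ θ in I, Real.exp (-(s ^ 2 * θ ^ 2 / 2))| ≤
      (∫ θ in I, M * Real.exp (-(s ^ 2 * θ ^ 2 / 8))) + ∫ _ in I, δ := by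
    rw [← integral_sub hfI g2.integrableOn, ← integral_add g8.integrableOn hδI,
      ← Real.norm_eq_abs]
    refine norm_integral_le_of_norm_le (g8.integrableOn.add hδI) ?_
    filter_upwards [ae_restrict_mem hIm] with θ hθ
    exact h θ (abs_le.2 ⟨hθ.1.le, hθ.2⟩)
  have h2 : |∫ θ in Iᶜ, Real.exp (-(s ^ 2 * θ ^ 2 / 2))| ≤
      ∫ θ in Iᶜ, M * Real.exp (-(s ^ 2 * θ ^ 2 / 8)) := by
    rw [← Real.norm_eq_abs]
    refine norm_integral_le_of_norm_le g8.integrableOn ?_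
    filter_upwards [ae_restrict_mem hIm.compl] with θ hθ
    rw [Real.norm_eq_abs, Real.abs_exp]
    refine h' θ ?_
    by_contra hlt
    rw [not_le, abs_lt] at hlt
    exact hθ ⟨hlt.1, hlt.2.le⟩
  rw [hδ] at h1
  rw [abs_le] at *
  constructor <;> linarith [h1.1, h1.2, h2.1, h2.2]

end GaussianComparison

/-! ### The saddle point estimate for large `r` -/

section SaddlePoint

variable {S : Set ℕ} {r : ℝ}

/-- In terms of `v = s²θ²` one has `r²θ² ≤ e^{-r} v`, so each error monomial gains a factor
`e^{-r}`. The quartic remainder gives `v²`, the squared cubic phase `v³`, and the squared linear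
phase of `α` gives `α'(r)² v`. -/
theorem circle_estimate_near (hr : 1 ≤ r)
    (h12 : setExp (shiftDown S) r + setExp (shiftDown (shiftDown S)) r ≤ Real.exp r / 4)
    {s : ℝ} (hs : s ^ 2 = r * (r + 1) * Real.exp r) {θ : ℝ} (hθ : r * |θ| ≤ 1 / 4) {X Y : ℝ}
    (hX : X = Real.exp r * (Real.exp (-(r * (1 - Real.cos θ))) * Real.cos (r * Real.sin θ) - 1) +
      (setExp S r - (setExp S (r * Complex.exp (θ * Complex.I))).re))
    (hY : Y = Real.exp r * (Real.exp (-(r * (1 - Real.cos θ))) * Real.sin (r * Real.sin θ) -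
      r * θ) - (setExp S (r * Complex.exp (θ * Complex.I))).im) :
    |Real.exp X * Real.cos Y - Real.exp (-(s ^ 2 * θ ^ 2 / 2))| ≤
      4000 * (Real.exp (-r) * (1 + setExp (shiftDown S) r ^ 2)) *
        Real.exp (-(s ^ 2 * θ ^ 2 / 8)) := by
  have hr0 : 0 < r := by linarith
  set a₁ := setExp (shiftDown S) r with ha₁
  set a₂ := setExp (shiftDown (shiftDown S)) r with ha₂
  have ha₁0 : 0 ≤ a₁ := setExp_nonneg _ hr0.le
  have ha₂0 : 0 ≤ a₂ := setExp_nonneg _ hr0.le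
  -- This removes `α''` from the error, leaving only `α'`.
  have ha21 : a₂ ≤ 3 * a₁ + 3 := by
    have h1 := setExp_shiftDown_le (shiftDown S) hr0
    have h2 := Real.exp_one_lt_d9
    have h3 : Real.exp 1 * a₁ ≤ 3 * a₁ := by gcongr; linarith
    linarith
  obtain ⟨hA, hB⟩ := abs_exp_mul_cos_sub_le hr (hθ.trans (by norm_num))
  set v := s ^ 2 * θ ^ 2 with hv
  set e := Real.exp r with he
  have he0 : 0 < e := Real.exp_pos r
  have hθ2 : 0 ≤ θ ^ 2 := sq_nonneg θ
  have hv0 : 0 ≤ v := by positivity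
  have hvr : e * (r ^ 2 * θ ^ 2) ≤ v := by
    rw [hv, hs]
    have : 0 ≤ r * e * θ ^ 2 := by positivity
    linarith
  have hei : Real.exp (-r) * e = 1 := by rw [he, ← Real.exp_add]; simp
  have hrv : r ^ 2 * θ ^ 2 ≤ Real.exp (-r) * v := by
    calc r ^ 2 * θ ^ 2 = Real.exp (-r) * (e * (r ^ 2 * θ ^ 2)) := by
          rw [← mul_assoc, hei, one_mul]
      _ ≤ _ := by gcongr
  have hn0 : 0 < Real.exp (-r) := Real.exp_pos _
  have hc : r ^ 2 * θ ^ 2 ≤ 1 / 16 := by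
    rw [← sq_abs θ, ← mul_pow]
    calc (r * |θ|) ^ 2 ≤ (1 / 4) ^ 2 := by gcongr
      _ = _ := by norm_num
  have hre := setExp_sub_circle_re_le S hr0.le θ
  have hre0 := setExp_circle_re_le S hr0.le θ
  have him := abs_setExp_circle_im_le S hr0.le θ
  rw [← ha₁, ← ha₂] at hre
  rw [← ha₁] at him
  have hq : (r ^ 2 * a₂ + r * a₁) * (θ ^ 2 / 2) ≤ (a₁ + a₂) * (r ^ 2 * θ ^ 2) / 2 := by
    have : r * a₁ ≤ r ^ 2 * a₁ := by
      gcongr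
      nlinarith
    calc (r ^ 2 * a₂ + r * a₁) * (θ ^ 2 / 2) ≤ (r ^ 2 * a₂ + r ^ 2 * a₁) * (θ ^ 2 / 2) := by gcongr
      _ = _ := by ring
  have hx : |X + v / 2| ≤ e * (r ^ 4 * θ ^ 4) + (a₁ + a₂) * (r ^ 2 * θ ^ 2) / 2 := by
    have e1 : X + v / 2 = e * (Real.exp (-(r * (1 - Real.cos θ))) * Real.cos (r * Real.sin θ) - 1 +
        (r + r ^ 2) * θ ^ 2 / 2) +
        (setExp S r - (setExp S (r * Complex.exp (θ * Complex.I))).re) := by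
      rw [hX, hv, hs]; ring
    rw [e1]
    refine (abs_add_le _ _).trans (add_le_add ?_ ?_)
    · rw [abs_mul, abs_of_pos he0]; gcongr
    · rw [abs_of_nonneg (by linarith)]
      exact hre.trans hq
  have hx4 : e * (r ^ 4 * θ ^ 4) ≤ v / 16 := by
    calc e * (r ^ 4 * θ ^ 4) = e * (r ^ 2 * θ ^ 2) * (r ^ 2 * θ ^ 2) := by ring
      _ ≤ v * (1 / 16) := by gcongr
      _ = _ := by ring
  have hx2 : (a₁ + a₂) * (r ^ 2 * θ ^ 2) / 2 ≤ v / 8 := by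
    calc (a₁ + a₂) * (r ^ 2 * θ ^ 2) / 2 ≤ e / 4 * (r ^ 2 * θ ^ 2) / 2 := by gcongr
      _ ≤ _ := by linarith
  have hdom := abs_exp_mul_cos_sub_exp_le (X := X) (Y := Y) (v := v) (by linarith)
  have hx4' : e * (r ^ 4 * θ ^ 4) ≤ Real.exp (-r) * v ^ 2 := by
    calc e * (r ^ 4 * θ ^ 4) = e * (r ^ 2 * θ ^ 2) * (r ^ 2 * θ ^ 2) := by ring
      _ ≤ v * (Real.exp (-r) * v) := by gcongr
      _ = _ := by ring
  have hx2' : (a₁ + a₂) * (r ^ 2 * θ ^ 2) / 2 ≤ Real.exp (-r) * ((1 + a₁ ^ 2) * (3 * v)) := by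
    have h1 : (a₁ + a₂) / 2 ≤ 3 * (1 + a₁ ^ 2) := by nlinarith [sq_nonneg (a₁ - 1)]
    calc (a₁ + a₂) * (r ^ 2 * θ ^ 2) / 2 = (a₁ + a₂) / 2 * (r ^ 2 * θ ^ 2) := by ring
      _ ≤ 3 * (1 + a₁ ^ 2) * (Real.exp (-r) * v) := by gcongr
      _ = _ := by ring
  have hy : |Y| ≤ e * (r ^ 3 * |θ| ^ 3) + r * a₁ * |θ| := by
    rw [hY]
    refine (abs_sub _ _).trans (add_le_add ?_ him)
    rw [abs_mul, abs_of_pos he0]; gcongr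
  have hy2 : Y ^ 2 / 2 ≤ Real.exp (-r) * (v ^ 3 + a₁ ^ 2 * v) := by
    have h1 : Y ^ 2 ≤ (e * (r ^ 3 * |θ| ^ 3) + r * a₁ * |θ|) ^ 2 := by
      rw [← sq_abs Y]; gcongr
    have h2 : (e * (r ^ 3 * |θ| ^ 3)) ^ 2 ≤ Real.exp (-r) * v ^ 3 := by
      calc (e * (r ^ 3 * |θ| ^ 3)) ^ 2 = e ^ 2 * (r ^ 2 * |θ| ^ 2) ^ 3 := by ring
        _ = (e * (r ^ 2 * θ ^ 2)) ^ 2 * (r ^ 2 * θ ^ 2) := by rw [sq_abs]; ring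
        _ ≤ v ^ 2 * (Real.exp (-r) * v) := by gcongr
        _ = _ := by ring
    have h3 : (r * a₁ * |θ|) ^ 2 ≤ Real.exp (-r) * (a₁ ^ 2 * v) := by
      calc (r * a₁ * |θ|) ^ 2 = a₁ ^ 2 * (r ^ 2 * θ ^ 2) := by rw [mul_pow, sq_abs]; ring
        _ ≤ a₁ ^ 2 * (Real.exp (-r) * v) := by gcongr
        _ = _ := by ring
    have h4 := add_sq_le (a := e * (r ^ 3 * |θ| ^ 3)) (b := r * a₁ * |θ|)
    linarith
  have htot : |X + v / 2| + Y ^ 2 / 2 ≤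
      Real.exp (-r) * (1 + a₁ ^ 2) * (v ^ 3 + v ^ 2 + 4 * v) := by
    have h1 : 0 ≤ Real.exp (-r) * a₁ ^ 2 * (v ^ 3 + v ^ 2) := by positivity
    have h2 : 0 ≤ Real.exp (-r) * v := by positivity
    linarith
  calc _ ≤ Real.exp (-(v / 4)) * (|X + v / 2| + Y ^ 2 / 2) := hdom
    _ ≤ Real.exp (-(v / 4)) * (Real.exp (-r) * (1 + a₁ ^ 2) * (v ^ 3 + v ^ 2 + 4 * v)) := by gcongr
    _ = Real.exp (-r) * (1 + a₁ ^ 2) * ((v ^ 3 + v ^ 2 + 4 * v) * Real.exp (-(v / 4))) := by ring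
    _ ≤ Real.exp (-r) * (1 + a₁ ^ 2) * (4000 * Real.exp (-(v / 8))) := by
        exact mul_le_mul_of_nonneg_left (cubic_mul_exp_neg_le hv0) (by positivity)
    _ = _ := by ring

/-- From `π² < 10`, `r(1 - cos θ) ≥ rθ²/5 ≥ 1/(80r)`, so the real part of `e^z` drops by at least
`e^r/(160r)`. The series `α` gives back at most `2α(r) ≤ e^r/(320r)`, and what remains is at least
`3r`. -/
theorem circle_estimate_far (hr : 1 ≤ r) (h0 : setExp S r ≤ Real.exp r / (640 * r))
    (hexp : 960 * r ^ 2 ≤ Real.exp r) {θ : ℝ} (hθ : 1 / 4 ≤ r * |θ|) (hθπ : |θ| ≤ Real.pi) {X : ℝ}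
    (hX : X = Real.exp r * (Real.exp (-(r * (1 - Real.cos θ))) * Real.cos (r * Real.sin θ) - 1) +
      (setExp S r - (setExp S (r * Complex.exp (θ * Complex.I))).re)) :
    Real.exp X ≤ Real.exp (-(3 * r)) := by
  have hr0 : 0 < r := by linarith
  have he0 : 0 < Real.exp r := Real.exp_pos r
  have hre := neg_setExp_le_circle_re S hr0.le θ
  have hpi : Real.pi ^ 2 < 10 := by
    nlinarith [Real.pi_lt_d2, Real.pi_pos]
  have hcos : 1 / (80 * r) ≤ r * (1 - Real.cos θ) := by
    have h1 := Real.cos_le_one_sub_mul_cos_sq hθπ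
    have h2 : (1 / 4) ^ 2 ≤ (r * |θ|) ^ 2 := by gcongr
    rw [mul_pow, sq_abs] at h2
    have h3 : 2 / 10 ≤ 2 / Real.pi ^ 2 := by gcongr
    have h4 : 2 / 10 * θ ^ 2 ≤ 1 - Real.cos θ := by nlinarith [sq_nonneg θ]
    rw [div_le_iff₀ (by positivity)]
    nlinarith
  have hE : Real.exp (-(r * (1 - Real.cos θ))) ≤ 1 - 1 / (160 * r) := by
    have hy : 0 < 1 / (80 * r) := by positivity
    have hy1 : 1 / (80 * r) ≤ 1 := by
      rw [div_le_one (by positivity)]; linarith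
    have e1 : 1 / (160 * r) = 1 / (80 * r) / 2 := by field_simp; norm_num
    rw [e1]
    set y := 1 / (80 * r)
    have h2 : Real.exp (-y) ≤ 1 - y / 2 := by
      have h4 : (1 - y / 2) * Real.exp y ≥ 1 := by
        nlinarith [Real.add_one_le_exp y]
      have h5 : Real.exp y * Real.exp (-y) = 1 := by rw [← Real.exp_add]; simp
      nlinarith [Real.exp_pos (-y)]
    exact (Real.exp_le_exp.2 (by linarith)).trans h2
  have hEc : Real.exp (-(r * (1 - Real.cos θ))) * Real.cos (r * Real.sin θ) ≤
      1 - 1 / (160 * r) :=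
    (mul_le_of_le_one_right (Real.exp_pos _).le (Real.cos_le_one _)).trans hE
  refine Real.exp_le_exp.2 ?_
  have h1 := mul_le_mul_of_nonneg_left hEc he0.le
  have h2 : 3 * r ≤ Real.exp r * (1 / (320 * r)) := by
    rw [mul_one_div, le_div_iff₀ (by positivity)]
    nlinarith
  have h3 : Real.exp r * (1 / (160 * r)) = 2 * (Real.exp r * (1 / (320 * r))) := by
    field_simp; norm_num
  have h4 : Real.exp r / (640 * r) = Real.exp r * (1 / (320 * r)) / 2 := by
    field_simp; norm_num
  rw [hX]
  linarith

theorem gaussian_far_le (hr : 1 ≤ r) (hexp : 960 * r ^ 2 ≤ Real.exp r)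
    {s : ℝ} (hs : s ^ 2 = r * (r + 1) * Real.exp r) {θ : ℝ} (hθ : 1 / 4 ≤ r * |θ|) :
    Real.exp (-(s ^ 2 * θ ^ 2 / 2)) ≤ Real.exp (-r) * Real.exp (-(s ^ 2 * θ ^ 2 / 8)) := by
  rw [← Real.exp_add]
  refine Real.exp_le_exp.2 ?_
  have h2 : (1 / 4) ^ 2 ≤ (r * |θ|) ^ 2 := by gcongr
  rw [mul_pow, sq_abs] at h2
  have h3 : Real.exp r * (1 / 16) ≤ s ^ 2 * θ ^ 2 := by
    rw [hs]
    have : 0 ≤ r * Real.exp r * θ ^ 2 := by positivity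
    nlinarith [Real.exp_pos r]
  nlinarith

theorem abs_circle_integral_sub_le (hS : 0 ∉ S) (hr : 1 ≤ r) {n : ℕ} (hn : r * Real.exp r = n)
    (h12 : setExp (shiftDown S) r + setExp (shiftDown (shiftDown S)) r ≤ Real.exp r / 4)
    (h0 : setExp S r ≤ Real.exp r / (640 * r)) (hexp : 960 * r ^ 2 ≤ Real.exp r)
    {s : ℝ} (hs0 : 0 < s) (hs : s ^ 2 = r * (r + 1) * Real.exp r) :
    |Real.exp (-(Real.exp r - 1 - setExp S r)) * (∫ θ in (-Real.pi)..Real.pi,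
        Real.exp (setExp {k | k ≠ 0 ∧ k ∉ S} (r * Complex.exp (θ * Complex.I))).re *
        Real.cos ((setExp {k | k ≠ 0 ∧ k ∉ S} (r * Complex.exp (θ * Complex.I))).im - n * θ)) -
      √(2 * Real.pi) / s| ≤
      50000 * (Real.exp (-r) * (1 + setExp (shiftDown S) r ^ 2)) / s := by
  have hr0 : 0 < r := by linarith
  rw [← intervalIntegral.integral_const_mul]
  set ε := Real.exp (-r) * (1 + setExp (shiftDown S) r ^ 2) with hε
  have hεr : Real.exp (-r) ≤ ε :=
    le_mul_of_one_le_right (Real.exp_pos _).le (by linarith [sq_nonneg (setExp (shiftDown S) r)])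
  have hε0 : 0 < ε := (Real.exp_pos _).trans_le hεr
  have hcont : Continuous (fun θ : ℝ => Real.exp (-(Real.exp r - 1 - setExp S r)) *
      (Real.exp (setExp {k | k ≠ 0 ∧ k ∉ S} (r * Complex.exp (θ * Complex.I))).re *
      Real.cos ((setExp {k | k ≠ 0 ∧ k ∉ S} (r * Complex.exp (θ * Complex.I))).im - n * θ))) := by
    have := (differentiable_setExp {k | k ≠ 0 ∧ k ∉ S}).continuous
    have h1 : Continuous (fun θ : ℝ =>
        setExp {k | k ≠ 0 ∧ k ∉ S} (r * Complex.exp (θ * Complex.I))) := by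
      fun_prop
    have h2 := Complex.continuous_re.comp h1
    have h3 := Complex.continuous_im.comp h1
    simp only [Function.comp_def] at h2 h3
    fun_prop
  -- Substituting `n = r e^r` puts `e^r · rθ` in the phase, where it cancels the linear part of `Im
  -- e^z`.
  have hform : ∀ θ : ℝ, Real.exp (-(Real.exp r - 1 - setExp S r)) *
      (Real.exp (setExp {k | k ≠ 0 ∧ k ∉ S} (r * Complex.exp (θ * Complex.I))).re *
      Real.cos ((setExp {k | k ≠ 0 ∧ k ∉ S} (r * Complex.exp (θ * Complex.I))).im - n * θ)) =
      Real.exp (Real.exp r * (Real.exp (-(r * (1 - Real.cos θ))) * Real.cos (r * Real.sin θ) - 1) +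
        (setExp S r - (setExp S (r * Complex.exp (θ * Complex.I))).re)) *
      Real.cos (Real.exp r * (Real.exp (-(r * (1 - Real.cos θ))) * Real.sin (r * Real.sin θ) -
        r * θ) - (setExp S (r * Complex.exp (θ * Complex.I))).im) := by
    intro θ
    have e1 : Real.exp r * Real.exp (-(r * (1 - Real.cos θ))) = Real.exp (r * Real.cos θ) := by
      rw [← Real.exp_add]; ring_nf
    rw [setExp_compl_sdiff_zero hS, ← mul_assoc, ← Real.exp_add, ← hn]
    simp only [Complex.sub_re, Complex.sub_im, Complex.one_re, Complex.one_im, Complex.exp_re,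
      Complex.exp_im, Complex.mul_re, Complex.mul_im,
      Complex.ofReal_re, Complex.ofReal_im, Complex.I_re, Complex.I_im, mul_zero, mul_one, zero_mul,
      sub_zero, add_zero, Real.exp_zero, one_mul]
    congr 2
    · linear_combination -Real.cos (r * Real.sin θ) * e1
    · linear_combination -Real.sin (r * Real.sin θ) * e1
  -- The uniform error `e^{-3r}` is affordable because `s ≤ 2e^{2r}`. The total is at most `(4000·6
  -- + 16) ε / s`, well inside `50000 ε / s`.
  have hmain := abs_intervalIntegral_sub_gaussian_le hcont (s := s) (M := 4000 * ε)
    (δ := Real.exp (-(3 * r))) hs0 ?_ ?_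
  · refine hmain.trans ?_
    have h8 : √(8 * Real.pi) ≤ 6 := by
      rw [Real.sqrt_le_left (by norm_num)]
      linarith [Real.pi_lt_d2]
    have hs4 : s ≤ 2 * (r * Real.exp r) := by
      refine (sq_le_sq₀ hs0.le (by positivity)).1 ?_
      have h1 : 1 ≤ Real.exp r := Real.one_le_exp hr0.le
      rw [hs]
      calc r * (r + 1) * Real.exp r ≤ r * (r + r) * (Real.exp r * Real.exp r) := by
            gcongr
            exact le_mul_of_one_le_left (Real.exp_pos r).le h1
        _ ≤ (2 * (r * Real.exp r)) ^ 2 := by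
            have : 0 ≤ (r * Real.exp r) ^ 2 := sq_nonneg _
            linarith
    have hre : r ≤ Real.exp r := by linarith [Real.add_one_le_exp r]
    have hδs : Real.exp (-(3 * r)) * s ≤ 2 * ε := by
      calc Real.exp (-(3 * r)) * s
          ≤ Real.exp (-(3 * r)) * (2 * (Real.exp r * Real.exp r)) := by
            refine mul_le_mul_of_nonneg_left (hs4.trans ?_) (Real.exp_pos _).le
            gcongr
        _ = 2 * Real.exp (-r) := by
            rw [mul_left_comm, ← Real.exp_add, ← Real.exp_add]; ring_nf
        _ ≤ 2 * ε := by gcongr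
    rw [le_div_iff₀ hs0, add_mul, mul_assoc (4000 * ε), div_mul_cancel₀ _ hs0.ne']
    have h1 : 4000 * ε * √(8 * Real.pi) ≤ 4000 * ε * 6 := by gcongr
    have h2 : 2 * Real.pi * (Real.exp (-(3 * r)) * s) ≤ 2 * 4 * (2 * ε) := by
      gcongr
      linarith [Real.pi_lt_d2]
    linarith
  · intro θ hθ
    rw [hform]
    rcases le_total (r * |θ|) (1 / 4) with hc | hc
    · refine (circle_estimate_near hr h12 hs hc rfl rfl).trans ?_
      exact le_add_of_nonneg_right (Real.exp_pos _).le
    · have h1 := circle_estimate_far hr h0 hexp hc hθ rfl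
      have h2 := gaussian_far_le hr hexp hs hc
      refine (abs_sub _ _).trans ?_
      rw [abs_mul, Real.abs_exp, Real.abs_exp, add_comm]
      refine add_le_add (h2.trans ?_)
        ((mul_le_of_le_one_right (Real.exp_pos _).le (Real.abs_cos_le_one _)).trans h1)
      gcongr
      linarith
  · intro θ hθ
    refine (gaussian_far_le hr hexp hs ?_).trans ?_
    · nlinarith [Real.pi_gt_three]
    · gcongr
      linarith

end SaddlePoint

/-! ### The roots of `η(1 - log η) = 1/2` -/

section EtaRoots

open Set

theorem strictMonoOn_mul_one_sub_log :
    StrictMonoOn (fun x : ℝ => x * (1 - Real.log x)) (Icc 0 1) ∧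
    StrictAntiOn (fun x : ℝ => x * (1 - Real.log x)) (Ici 1) := by
  have hc : Continuous (fun x : ℝ => x * (1 - Real.log x)) := by
    have : (fun x : ℝ => x * (1 - Real.log x)) = fun x => x + Real.negMulLog x := by
      funext x; rw [Real.negMulLog]; ring
    rw [this]
    exact continuous_id.add Real.continuous_negMulLog
  have hd : ∀ x : ℝ, 0 < x → deriv (fun x : ℝ => x * (1 - Real.log x)) x = -Real.log x := by
    intro x hx
    have := ((hasDerivAt_id x).mul ((Real.hasDerivAt_log hx.ne').const_sub 1)).deriv
    rw [show (fun x : ℝ => x * (1 - Real.log x)) = id * (fun x => 1 - Real.log x) from rfl, this]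
    simp only [id]
    field_simp
    ring
  constructor
  · refine strictMonoOn_of_deriv_pos (convex_Icc 0 1) hc.continuousOn fun x hx => ?_
    rw [interior_Icc] at hx
    rw [hd x hx.1]
    linarith [Real.log_neg hx.1 hx.2]
  · refine strictAntiOn_of_deriv_neg (convex_Ici 1) hc.continuousOn fun x hx => ?_
    rw [interior_Ici, mem_Ioi] at hx
    rw [hd x (by linarith)]
    linarith [Real.log_pos hx]

/-- Scaling by `4` and by `1/2` moves the arguments close to `1`, where 14 and 9 terms of the series
of `log (1 - x)` are accurate enough. -/
theorem mul_one_sub_log_bounds :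
    (0.1866823 : ℝ) * (1 - Real.log 0.1866823) < 1 / 2 ∧
    1 / 2 < (0.1866824 : ℝ) * (1 - Real.log 0.1866824) ∧
    1 / 2 < (2.1555352 : ℝ) * (1 - Real.log 2.1555352) ∧
    (2.1555353 : ℝ) * (1 - Real.log 2.1555353) < 1 / 2 := by
  have l2 := Real.log_two_gt_d9
  have l2' := Real.log_two_lt_d9
  have e1 : Real.log 0.1866823 = Real.log (1 - 0.2532708) - 2 * Real.log 2 := by
    rw [← Real.log_rpow (by norm_num), ← Real.log_div (by norm_num) (by norm_num)]
    norm_num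
  have e2 : Real.log 0.1866824 = Real.log (1 - 0.2532704) - 2 * Real.log 2 := by
    rw [← Real.log_rpow (by norm_num), ← Real.log_div (by norm_num) (by norm_num)]
    norm_num
  have e3 : Real.log 2.1555352 = Real.log (1 - (-0.0777676)) + Real.log 2 := by
    rw [← Real.log_mul (by norm_num) (by norm_num)]
    norm_num
  have e4 : Real.log 2.1555353 = Real.log (1 - (-0.07776765)) + Real.log 2 := by
    rw [← Real.log_mul (by norm_num) (by norm_num)]
    norm_num
  have b1 := Real.abs_log_sub_add_sum_range_le (x := 0.2532708)
    (by rw [abs_of_pos] <;> norm_num) 14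
  have b2 := Real.abs_log_sub_add_sum_range_le (x := 0.2532704)
    (by rw [abs_of_pos] <;> norm_num) 14
  have b3 := Real.abs_log_sub_add_sum_range_le (x := -0.0777676)
    (by rw [abs_of_neg] <;> norm_num) 9
  have b4 := Real.abs_log_sub_add_sum_range_le (x := -0.07776765)
    (by rw [abs_of_neg] <;> norm_num) 9
  rw [abs_of_pos (show (0 : ℝ) < 0.2532708 by norm_num)] at b1
  rw [abs_of_pos (show (0 : ℝ) < 0.2532704 by norm_num)] at b2
  rw [abs_of_neg (show (-0.0777676 : ℝ) < 0 by norm_num)] at b3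
  rw [abs_of_neg (show (-0.07776765 : ℝ) < 0 by norm_num)] at b4
  rw [abs_le] at b1 b2 b3 b4
  rw [e1, e2, e3, e4]
  generalize Real.log 2 = L at *
  generalize Real.log (1 - 0.2532708) = L1 at *
  generalize Real.log (1 - 0.2532704) = L2 at *
  generalize Real.log (1 - (-0.0777676)) = L3 at *
  generalize Real.log (1 - (-0.07776765)) = L4 at *
  simp only [Finset.sum_range_succ, Finset.sum_range_zero] at b1 b2 b3 b4
  norm_num1 at b1 b2 b3 b4 ⊢
  refine ⟨?_, ?_, ?_, ?_⟩ <;> linarith [b1.1, b1.2, b2.1, b2.2, b3.1, b3.2, b4.1, b4.2]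

theorem exists_eta_roots :
    ∃ η₁ η₂ : ℝ, η₁ ∈ Ico (0.1866823 : ℝ) 0.1866824 ∧ η₂ ∈ Ico (2.1555352 : ℝ) 2.1555353 ∧
      {η : ℝ | 0 < η ∧ η * (1 - Real.log η) = 1 / 2} = {η₁, η₂} := by
  obtain ⟨b1, b2, b3, b4⟩ := mul_one_sub_log_bounds
  obtain ⟨hm, ha⟩ := strictMonoOn_mul_one_sub_log
  have hc : ContinuousOn (fun x : ℝ => x * (1 - Real.log x)) (Ioi 0) :=
    continuousOn_id.mul (continuousOn_const.sub (Real.continuousOn_log.mono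
      fun x hx => (show (0 : ℝ) < x from hx).ne'))
  obtain ⟨η₁, h1, h1'⟩ := intermediate_value_Ico (show (0.1866823 : ℝ) ≤ 0.1866824 by norm_num)
    (hc.mono fun x hx => by have := hx.1; rw [mem_Ioi]; linarith) ⟨b1.le, b2⟩
  obtain ⟨η₂, h2, h2'⟩ := intermediate_value_Ico' (show (2.1555352 : ℝ) ≤ 2.1555353 by norm_num)
    (hc.mono fun x hx => by have := hx.1; rw [mem_Ioi]; linarith) ⟨b4, b3.le⟩
  refine ⟨η₁, η₂, h1, h2, ?_⟩
  have p1 := h1.1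
  have p1' := h1.2
  have p2 := h2.1
  ext η
  simp only [mem_ofPred_eq, mem_insert_iff, mem_singleton_iff]
  constructor
  · rintro ⟨h0, h⟩
    rcases le_total η 1 with hη | hη
    · left
      exact hm.injOn ⟨h0.le, hη⟩ ⟨by linarith, by linarith⟩ (h.trans h1'.symm)
    · right
      exact ha.injOn hη (mem_Ici.2 (by linarith)) (h.trans h2'.symm)
  · rintro (rfl | rfl)
    · exact ⟨by linarith, h1'⟩
    · exact ⟨by linarith, h2'⟩

end EtaRoots

/-! ### Uniform constants and conclusion -/

section Assembly

open Filter

theorem exists_forall_exp_dominates {K ρ : ℝ} (hK : 0 < K) (hρ : ρ < 1) :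
    ∃ R : ℝ, 1 ≤ R ∧ ∀ r : ℝ, R ≤ r → 960 * r ^ 2 ≤ Real.exp r ∧
      640 * r * (K * Real.exp (ρ * r)) ≤ Real.exp r := by
  have h1 := tendsto_rpow_mul_exp_neg_mul_atTop_nhds_zero (2 : ℕ) 1 one_pos
  have h2 := tendsto_rpow_mul_exp_neg_mul_atTop_nhds_zero (1 : ℕ) (1 - ρ) (by linarith)
  have h3 := (h1.eventually_le_const (show (0 : ℝ) < 1 / 960 by norm_num)).and
    (h2.eventually_le_const (show (0 : ℝ) < 1 / (640 * K) by positivity))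
  obtain ⟨R, hR⟩ := eventually_atTop.1 h3
  refine ⟨max R 1, le_max_right _ _, fun r hr => ?_⟩
  obtain ⟨h4, h5⟩ := hR r ((le_max_left _ _).trans hr)
  rw [Real.rpow_natCast] at h4 h5
  have he := Real.exp_pos r
  constructor
  · have h6 := mul_le_mul_of_nonneg_right h4 he.le
    rw [mul_assoc, ← Real.exp_add, show -1 * r + r = 0 by ring, Real.exp_zero] at h6
    linarith
  · have h6 := mul_le_mul_of_nonneg_right h5 he.le
    rw [mul_assoc, ← Real.exp_add, show -(1 - ρ) * r + r = ρ * r by ring, pow_one] at h6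
    have h7 : 640 * K * (r * Real.exp (ρ * r)) ≤ 640 * K * (1 / (640 * K) * Real.exp r) := by
      gcongr
    rw [← mul_assoc, ← mul_assoc, mul_one_div_cancel (by positivity), one_mul] at h7
    linarith

/-- The integrand is largest in modulus at `θ = 0`; this crude bound serves the range of bounded
`r`. -/
theorem abs_circle_integral_le {S : Set ℕ} (hS : 0 ∉ S) {r : ℝ} (hr : 0 ≤ r) (n : ℕ) :
    |Real.exp (-(Real.exp r - 1 - setExp S r)) * (∫ θ in (-Real.pi)..Real.pi,
        Real.exp (setExp {k | k ≠ 0 ∧ k ∉ S} (r * Complex.exp (θ * Complex.I))).re *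
        Real.cos ((setExp {k | k ≠ 0 ∧ k ∉ S} (r * Complex.exp (θ * Complex.I))).im - n * θ))| ≤
      2 * Real.pi := by
  have hT : setExp {k | k ≠ 0 ∧ k ∉ S} r = Real.exp r - 1 - setExp S r := by
    have h := setExp_compl_sdiff_zero hS (r : ℂ)
    rw [setExp_ofReal, setExp_ofReal] at h
    exact_mod_cast h
  rw [← hT]
  have h := intervalIntegral.norm_integral_le_of_norm_le_const (a := -Real.pi) (b := Real.pi)
    (C := Real.exp (setExp {k | k ≠ 0 ∧ k ∉ S} r))
    (f := fun θ => Real.exp (setExp {k | k ≠ 0 ∧ k ∉ S} (r * Complex.exp (θ * Complex.I))).re *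
        Real.cos ((setExp {k | k ≠ 0 ∧ k ∉ S} (r * Complex.exp (θ * Complex.I))).im - n * θ))
    fun θ _ => by
      rw [norm_mul, Real.norm_eq_abs, Real.norm_eq_abs, Real.abs_exp]
      exact (mul_le_of_le_one_right (Real.exp_pos _).le (Real.abs_cos_le_one _)).trans
        (Real.exp_le_exp.2 (setExp_circle_re_le _ hr θ))
  rw [abs_mul, Real.abs_exp, Real.exp_neg, inv_mul_le_iff₀ (Real.exp_pos _)]
  refine h.trans (le_of_eq ?_)
  rw [abs_of_pos (by linarith [Real.pi_pos])]
  ring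

/-- The condition `δ₁ < 1 < δ₂` already gives `ρ < 1`. The stronger `δ₁ < η₁`, `η₂ < δ₂` corresponds
to `ρ < 1/2`, which makes `α'(r)²/e^r` tend to `0`. -/
theorem avoidingPartitions_asymptotics {δ₁ δ₂ : ℝ} (h₁ : 0 < δ₁) (h₁' : δ₁ < 1) (h₂ : 1 < δ₂) :
    ∃ C : ℝ, 0 < C ∧
      ∀ n : ℕ, 1 ≤ n → ∀ r : ℝ, r * Real.exp r = n →
        ∀ S : Set ℕ, 0 ∉ S → (∀ k ∈ S, (k : ℝ) ∉ Set.Icc (δ₁ * r) (δ₂ * r)) →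
          ∃ E : ℝ,
            |E| ≤ C * ((1 + (deriv (blockSeries S) r) ^ 2) / Real.exp r) ∧
            (avoidingPartitions n S : ℝ) =
              (Nat.factorial n : ℝ) * Real.exp (Real.exp r - 1 - blockSeries S r) /
                (r ^ n * Real.sqrt (2 * Real.pi * r * (r + 1) * Real.exp r)) * (1 + E) := by
  obtain ⟨K, ρ, hK, hρ, hbound⟩ := exists_setExp_shiftDown_le h₁ h₁' h₂
  obtain ⟨R, hR1, hR⟩ := exists_forall_exp_dominates hK hρ
  -- For `r ≤ R` this bounds `q s + 1`, the trivial estimate of the relative error.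
  set D := √(2 * Real.pi) * √(R * (R + 1) * Real.exp R) + 1 with hD
  have hD0 : 0 < D := by positivity
  refine ⟨50000 + D * Real.exp R, by positivity, fun n hn r hrn S hS hSr => ?_⟩
  have hr0 : 0 < r := by
    have : (0 : ℝ) < r * Real.exp r := by rw [hrn]; exact_mod_cast hn
    exact pos_of_mul_pos_left this (Real.exp_pos r).le
  set q := √(2 * Real.pi) with hq
  set s := √(r * (r + 1) * Real.exp r) with hs
  have hs2 : s ^ 2 = r * (r + 1) * Real.exp r := Real.sq_sqrt (by positivity)
  have hq2 : q ^ 2 = 2 * Real.pi := Real.sq_sqrt (by positivity)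
  have hs0 : 0 < s := Real.sqrt_pos.2 (by positivity)
  have hq0 : 0 < q := Real.sqrt_pos.2 (by positivity)
  have hq1 : 1 ≤ q := Real.one_le_sqrt.2 (by linarith [Real.pi_gt_three])
  have hqs : √(2 * Real.pi * r * (r + 1) * Real.exp r) = q * s := by
    rw [hq, hs, ← Real.sqrt_mul (by positivity)]
    ring_nf
  have hcount := avoidingPartitions_eq_integral S n hr0
  have hlarge := fun h12 h0 hexp hr1 =>
    abs_circle_integral_sub_le hS (r := r) hr1 hrn h12 h0 hexp hs0 hs2
  have hsmall := abs_circle_integral_le hS hr0.le n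
  rw [blockSeries_eq_setExp, deriv_setExp, hqs]
  set J := ∫ θ in (-Real.pi)..Real.pi,
        Real.exp (setExp {k | k ≠ 0 ∧ k ∉ S} (r * Complex.exp (θ * Complex.I))).re *
        Real.cos ((setExp {k | k ≠ 0 ∧ k ∉ S} (r * Complex.exp (θ * Complex.I))).im - n * θ) with hJ
  set W := Real.exp (Real.exp r - 1 - setExp S r) with hW
  have hW0 : 0 < W := Real.exp_pos _
  rw [Real.exp_neg, ← hW] at hsmall hlarge
  set ε := (1 + setExp (shiftDown S) r ^ 2) / Real.exp r with hε
  have hεr : Real.exp (-r) * (1 + setExp (shiftDown S) r ^ 2) = ε := by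
    rw [hε, Real.exp_neg]; field_simp
  have hε0 : 0 < ε := by positivity
  rw [hεr] at hlarge
  -- The relative error is the normalised integral `W⁻¹J` divided by its Gaussian value `q/s`, minus
  -- `1`.
  refine ⟨s / q * (W⁻¹ * J - q / s), ?_, ?_⟩
  · rcases le_total R r with hRr | hRr
    · obtain ⟨hexp, hdom⟩ := hR r hRr
      have hr1 : 1 ≤ r := hR1.trans hRr
      have a0 := hbound r hr0 S hSr S 0 (by norm_num) (fun k hk => hk)
      have a1 := hbound r hr0 S hSr (shiftDown S) 1 (by norm_num) (fun k hk => hk)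
      have a2 := hbound r hr0 S hSr (shiftDown (shiftDown S)) 2 le_rfl (fun k hk => hk)
      set m := K * Real.exp (ρ * r) with hm
      have hm0 : 0 < m := by positivity
      have hmr : m ≤ r * m := le_mul_of_one_le_left hm0.le hr1
      have h := hlarge (by linarith) (by
        rw [le_div_iff₀ (by positivity)]
        have := mul_le_mul_of_nonneg_right a0 (show 0 ≤ 640 * r by positivity)
        linarith) hexp hr1
      rw [abs_mul, abs_of_pos (div_pos hs0 hq0)]
      calc s / q * |W⁻¹ * J - q / s| ≤ s / q * (50000 * ε / s) := by gcongr
        _ = 50000 * ε / q := by field_simp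
        _ ≤ 50000 * ε := div_le_self (by positivity) hq1
        _ ≤ _ := by
          gcongr
          linarith [mul_pos hD0 (Real.exp_pos R)]
    · have hsR : s ≤ √(R * (R + 1) * Real.exp R) := by
        rw [hs]
        gcongr
      -- For `r ≤ R` the claimed error is at least `e^{-R}`, so a bounded relative error is
      -- acceptable.
      have hεR : 1 ≤ Real.exp R * ε := by
        rw [← hεr, ← mul_assoc, ← Real.exp_add]
        exact one_le_mul_of_one_le_of_one_le (Real.one_le_exp (by linarith))
          (by linarith [sq_nonneg (setExp (shiftDown S) r)])
      have e1 : s / q * (W⁻¹ * J - q / s) = s / q * (W⁻¹ * J) - 1 := by field_simp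
      rw [e1]
      have h1 : |s / q * (W⁻¹ * J)| ≤ q * s := by
        rw [abs_mul, abs_of_pos (div_pos hs0 hq0)]
        calc s / q * |W⁻¹ * J| ≤ s / q * (2 * Real.pi) := by gcongr
          _ = q * s := by rw [← hq2]; field_simp
      calc |s / q * (W⁻¹ * J) - 1| ≤ q * s + 1 := (abs_sub _ _).trans (by rw [abs_one]; linarith)
        _ ≤ D := by rw [hD]; gcongr
        _ ≤ D * (Real.exp R * ε) := le_mul_of_one_le_right hD0.le hεR
        _ = D * Real.exp R * ε := by ring
        _ ≤ _ := by gcongr; linarith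
  · rw [hcount, ← hq2]
    have hrn0 : r ^ n ≠ 0 := by positivity
    field_simp
    ring

end Assembly

theorem theorem1 :
    ∃ η₁ η₂ : ℝ,
      η₁ ∈ Set.Ico (0.1866823 : ℝ) 0.1866824 ∧
      η₂ ∈ Set.Ico (2.1555352 : ℝ) 2.1555353 ∧
      {η : ℝ | 0 < η ∧ η * (1 - Real.log η) = 1 / 2} = {η₁, η₂} ∧
      ∀ δ₁ δ₂ : ℝ, 0 < δ₁ → δ₁ < η₁ → η₂ < δ₂ →
        ∃ C : ℝ, 0 < C ∧
          ∀ n : ℕ, 1 ≤ n → ∀ r : ℝ, r * Real.exp r = n →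
            ∀ S : Set ℕ, 0 ∉ S → (∀ k ∈ S, (k : ℝ) ∉ Set.Icc (δ₁ * r) (δ₂ * r)) →
              ∃ E : ℝ,
                |E| ≤ C * ((1 + (deriv (blockSeries S) r) ^ 2) / Real.exp r) ∧
                (avoidingPartitions n S : ℝ) =
                  (Nat.factorial n : ℝ) * Real.exp (Real.exp r - 1 - blockSeries S r) /
                    (r ^ n * Real.sqrt (2 * Real.pi * r * (r + 1) * Real.exp r)) * (1 + E) := by
  obtain ⟨η₁, η₂, h1, h2, h3⟩ := exists_eta_roots
  exact ⟨η₁, η₂, h1, h2, h3, fun δ₁ δ₂ hδ hδ₁ hδ₂ => avoidingPartitions_asymptotics hδ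
    (by linarith [h1.2]) (by linarith [h2.1])⟩
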